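/- **Theorem.** Let $n,m\ge 1$, let $\Omega\subset\mathbb R^n$ be a compact set with Lipschitz boundary, and let $K:\Omega\times\Omega\to\mathbb R$ be a Mercer kernel (continuous, symmetric, positive semidefinite) with $K\in C^{2m}(\Omega\times\Omega)$, i.e. $K$ is $2m$ times continuously differentiable in the interior and all its partial derivatives of order $\le 2m$ extend continuously to $\Omega\times\Omega$. Let $O_K[f](x)=\int_\Omega K(x,y)f(y)\,dy$ on $L_2(\Omega)$, let $\lambda_1,\lambda_2,\dots$ be all positive eigenvalues of $O_K$ counted with multiplicity (padded by zeros if there are only finitely many), and $\phi_1,\phi_2,\dots$ corresponding continuous orthonormal eigenfunctions. Put $$C_K^N=\sup_{x,y\in\Omega}\Big|K(x,y)-\sum_{i=1}^N\lambda_i\phi_i(x)\phi_i(y)\Big|,\qquad D_\alpha(x)=\partial_x^\alpha\partial_y^\alpha K(x,y)\big|_{y=x}\quad(\alpha\in\mathbb Z_{\ge0}^n).$$ For $1\le p\le\infty$ and $t\in[0,1]$ let $$D(t)=\sup_{u}\frac{\|u\|_{L_\infty(\Omega\times\Omega)}}{\|u\|_{L_2(\Omega\times\Omega)}^{1-t}\,\|D^mu\|_{L_p(\Omega\times\Omega)}^{t}+\|u\|_{L_2(\Omega\times\Omega)}}\in[0,\infty],\qquad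 \|D^mu\|_{L_p}=\max_{|\alpha|+|\beta|=m}\|\partial_x^\alpha\partial_y^\beta u\|_{L_p},$$ the supremum being over all nonzero $u\in L_2\cap L_p(\Omega\times\Omega)$ whose weak derivatives of order $m$ lie in $L_p$ (the optimal constant, possibly $+\infty$, in the $L_2$–$L_\infty$ Gagliardo–Nirenberg inequality on $\Omega\times\Omega$ with exponent $t$). Then: 1. If $p\in[1,\infty]$ and $p>n/m$, then with $\theta=\big(1+\frac{2m}{n}-\frac2p\big)^{-1}$ and $D=D(\theta)$, for all $N\ge 0$, $$C_K^N\le D\Big(\sum_{i>N}\lambda_i^2\Big)^{(1-\theta)/2}\max_{|\alpha|+|\beta|=m}\|\sqrt{D_\alpha}\|_{L_p(\Omega)}^\theta\|\sqrt{D_\beta}\|_{L_p(\Omega)}^\theta+D\Big(\sum_{i>N}\lambda_i^2\Big)^{1/2}.$$ The same inequality holds for all $N\ge 0$ with $\theta$ replaced by any $t\in[0,1]$ and $D$ by $D(t)$. 2. $C_K^N=O\big((\sum_{i>N}\lambda_i^2)^{m/(2m+n)}\big)$: there is a finite constant $c$, independent of $N$, with $C_K^N\le c\,\big(\sum_{i>N}\lambda_i^2\big)^{m/(2m+n)}$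 for all $N\ge 0$. (In $[0,\infty]$ the convention $0\cdot\infty=0$ is used.) -/

import Mathlib

open MeasureTheory Set
open scoped ENNReal NNReal ContDiff

noncomputable section

/-- `ℝⁿ` with its Euclidean norm. -/
abbrev Rn (n : ℕ) : Type := EuclideanSpace ℝ (Fin n)

/-- `Ω` has a Lipschitz boundary: near each of its boundary points, `Ω` is the set of points on or
above the graph of a Lipschitz function, where "above" is measured along some unit vector `ν`, and
the function depends only on the component of the point orthogonal to `ν`. -/
def HasLipschitzBoundary {n : ℕ} (Ω : Set (Rn n)) : Prop :=
  ∀ x₀ ∈ frontier Ω, ∃ (ν : Rn n) (L : ℝ≥0) (γ : Rn n → ℝ) (r : ℝ),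
    ‖ν‖ = 1 ∧ LipschitzWith L γ ∧ 0 < r ∧
      ∀ x ∈ Metric.ball x₀ r, x ∈ Ω ↔ γ (x - inner ℝ ν x • ν) ≤ inner ℝ ν x

/-- `f ∈ C^k(S)` for a closed set `S` (the closure of its interior): `f` is continuous on `S`,
it is `k` times continuously differentiable in the interior, and all its derivatives of order at
most `k` extend continuously to `S`. -/
def IsCk {F : Type*} [NormedAddCommGroup F] [NormedSpace ℝ F]
    (k : ℕ) (S : Set F) (f : F → ℝ) : Prop :=
  ContinuousOn f S ∧ ContDiffOn ℝ k f (interior S) ∧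
    ∀ j ≤ k, ∃ g : F → ContinuousMultilinearMap ℝ (fun _ : Fin j => F) ℝ,
      ContinuousOn g S ∧ EqOn g (iteratedFDeriv ℝ j f) (interior S)

/-- The length `|α|` of a multi-index. -/
def multiLength {n : ℕ} (α : Fin n → ℕ) : ℕ := ∑ i, α i

/-- The iterated directional derivative `∂_{e₁}^{α₁} ⋯ ∂_{eₙ}^{αₙ} f`. -/
def multiDeriv {n : ℕ} {F : Type*} [NormedAddCommGroup F] [NormedSpace ℝ F]
    (e : Fin n → F) (α : Fin n → ℕ) (f : F → ℝ) : F → ℝ :=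
  (List.finRange n).foldr
    (fun i g => (fun (h : F → ℝ) (z : F) => lineDeriv ℝ h z (e i))^[α i] g) f

/-- `∂_x^α ∂_y^β f` for a function `f(x, y)` on `ℝⁿ × ℝⁿ`. -/
def mixedDeriv {n : ℕ} (α β : Fin n → ℕ) (f : Rn n × Rn n → ℝ) : Rn n × Rn n → ℝ :=
  multiDeriv (fun i => (EuclideanSpace.single i (1 : ℝ), (0 : Rn n))) α
    (multiDeriv (fun i => ((0 : Rn n), EuclideanSpace.single i (1 : ℝ))) β f)

/-- `D_α(x) = ∂_x^α ∂_y^α K(x, y)` at `y = x`. -/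
def diagDeriv {n : ℕ} (K : Rn n × Rn n → ℝ) (α : Fin n → ℕ) (x : Rn n) : ℝ :=
  mixedDeriv α α K (x, x)

/-- A Mercer kernel on `Ω`: continuous, symmetric and positive semidefinite. -/
structure IsMercerKernel {n : ℕ} (Ω : Set (Rn n)) (K : Rn n × Rn n → ℝ) : Prop where
  continuousOn : ContinuousOn K (Ω ×ˢ Ω)
  symm : ∀ x ∈ Ω, ∀ y ∈ Ω, K (x, y) = K (y, x)
  nonneg : ∀ s : Finset (Rn n), (s : Set (Rn n)) ⊆ Ω → ∀ c : Rn n → ℝ,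
    0 ≤ ∑ x ∈ s, ∑ y ∈ s, c x * c y * K (x, y)

/-- The integral operator `O_K[f](x) = ∫_Ω K(x, y) f(y) dy`. -/
def integralOp {n : ℕ} (Ω : Set (Rn n)) (K : Rn n × Rn n → ℝ) (f : Rn n → ℝ) (x : Rn n) : ℝ :=
  ∫ y in Ω, K (x, y) * f y

/-- `(ev i)` enumerates all positive eigenvalues of `O_K` on `L₂(Ω)`, with multiplicities and in
any order, and `φ i` are corresponding (continuous) orthonormal eigenfunctions. Terms with
`ev i = 0` are padding, so that operators with finitely many positive eigenvalues are covered;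
there is no condition on `φ i` at such terms. `complete` says that nothing is missing: an
`L₂`-eigenfunction with a positive eigenvalue that is orthogonal to all listed ones vanishes. -/
structure IsPositiveEigensystem {n : ℕ} (Ω : Set (Rn n)) (K : Rn n × Rn n → ℝ)
    (ev : ℕ → ℝ) (φ : ℕ → Rn n → ℝ) : Prop where
  nonneg : ∀ i, 0 ≤ ev i
  continuousOn : ∀ i, 0 < ev i → ContinuousOn (φ i) Ω
  eigen : ∀ i, 0 < ev i → ∀ x ∈ Ω, integralOp Ω K (φ i) x = ev i * φ i x
  orthonormal : ∀ i j, 0 < ev i → 0 < ev j →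
    ∫ x in Ω, φ i x * φ j x = if i = j then 1 else 0
  complete : ∀ (μ : ℝ) (f : Rn n → ℝ), 0 < μ → MemLp f 2 (volume.restrict Ω) →
    (∀ᵐ x ∂(volume.restrict Ω), integralOp Ω K f x = μ * f x) →
    (∀ i, 0 < ev i → ∫ x in Ω, f x * φ i x = 0) →
    f =ᵐ[volume.restrict Ω] 0

/-- `C_K^N = sup_{x, y ∈ Ω} |K(x, y) - ∑_{i ≤ N} λ_i φ_i(x) φ_i(y)|`
(`i` starts at `0` here, so the first `N` terms are those with `i < N`). -/
def mercerError {n : ℕ} (Ω : Set (Rn n)) (K : Rn n × Rn n → ℝ)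
    (ev : ℕ → ℝ) (φ : ℕ → Rn n → ℝ) (N : ℕ) : ℝ≥0∞ :=
  ⨆ x ∈ Ω, ⨆ y ∈ Ω, ‖K (x, y) - ∑ i ∈ Finset.range N, ev i * φ i x * φ i y‖ₑ

/-- The tail `∑_{i > N} λ_i²`: all terms except the first `N`. -/
def sqTail (ev : ℕ → ℝ) (N : ℕ) : ℝ≥0∞ := ∑' i : ℕ, ENNReal.ofReal (ev (N + i) ^ 2)

/-- `v` is the weak derivative `∂_x^α ∂_y^β u` in the interior of `Ω × Ω`. -/
def IsWeakMixedDeriv {n : ℕ} (Ω : Set (Rn n)) (α β : Fin n → ℕ)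
    (u v : Rn n × Rn n → ℝ) : Prop :=
  ∀ ψ : Rn n × Rn n → ℝ, ContDiff ℝ ∞ ψ → HasCompactSupport ψ →
    tsupport ψ ⊆ interior (Ω ×ˢ Ω) →
    ∫ z in Ω ×ˢ Ω, u z * mixedDeriv α β ψ z =
      (-1) ^ (multiLength α + multiLength β) * ∫ z in Ω ×ˢ Ω, v z * ψ z

/-- The ratio in the Gagliardo–Nirenberg inequality on `Ω × Ω`, for a function `u` and the family
`v α β` of its weak derivatives of order `m`:
`‖u‖_∞ / (‖u‖₂^(1-θ) ‖D^m u‖_p^θ + ‖u‖₂)`, `‖D^m u‖_p = max_{|α|+|β|=m} ‖v α β‖_p`. -/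
def gnRatio {n : ℕ} (Ω : Set (Rn n)) (m : ℕ) (p : ℝ≥0∞) (θ : ℝ)
    (u : Rn n × Rn n → ℝ) (v : (Fin n → ℕ) → (Fin n → ℕ) → Rn n × Rn n → ℝ) : ℝ≥0∞ :=
  eLpNorm u ∞ (volume.restrict (Ω ×ˢ Ω)) /
    (eLpNorm u 2 (volume.restrict (Ω ×ˢ Ω)) ^ (1 - θ) *
      (⨆ (α : Fin n → ℕ) (β : Fin n → ℕ) (_ : multiLength α + multiLength β = m),
        eLpNorm (v α β) p (volume.restrict (Ω ×ˢ Ω))) ^ θ +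
      eLpNorm u 2 (volume.restrict (Ω ×ˢ Ω)))

/-- The optimal constant `D ∈ [0, ∞]` in the Gagliardo–Nirenberg inequality on `Ω × Ω`: the
supremum of the ratio over all nonzero `u ∈ L₂ ∩ L_p` with weak derivatives of order `m` in `L_p`
(for other `u` the quantity `‖D^m u‖_p` is infinite, and they do not contribute). -/
def gnConst {n : ℕ} (Ω : Set (Rn n)) (m : ℕ) (p : ℝ≥0∞) (θ : ℝ) : ℝ≥0∞ :=
  ⨆ (u : Rn n × Rn n → ℝ) (v : (Fin n → ℕ) → (Fin n → ℕ) → Rn n × Rn n → ℝ)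
    (_ : MemLp u 2 (volume.restrict (Ω ×ˢ Ω)))
    (_ : MemLp u p (volume.restrict (Ω ×ˢ Ω)))
    (_ : ¬ u =ᵐ[volume.restrict (Ω ×ˢ Ω)] 0)
    (_ : ∀ α β, multiLength α + multiLength β = m →
      IsWeakMixedDeriv Ω α β u (v α β) ∧ MemLp (v α β) p (volume.restrict (Ω ×ˢ Ω))),
    gnRatio Ω m p θ u v

/-- The right-hand side of the bound with exponent `θ`:
`D (∑_{i>N} λ_i²)^((1-θ)/2) max_{|α|+|β|=m} ‖√D_α‖_p^θ ‖√D_β‖_p^θ + D (∑_{i>N} λ_i²)^(1/2)`. -/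
def gnBound {n : ℕ} (Ω : Set (Rn n)) (K : Rn n × Rn n → ℝ) (ev : ℕ → ℝ)
    (m : ℕ) (p : ℝ≥0∞) (θ : ℝ) (N : ℕ) : ℝ≥0∞ :=
  gnConst Ω m p θ * sqTail ev N ^ ((1 - θ) / 2) *
      (⨆ (α : Fin n → ℕ) (β : Fin n → ℕ) (_ : multiLength α + multiLength β = m),
        eLpNorm (fun x => √(diagDeriv K α x)) p (volume.restrict Ω) ^ θ *
          eLpNorm (fun x => √(diagDeriv K β x)) p (volume.restrict Ω) ^ θ) +
    gnConst Ω m p θ * sqTail ev N ^ ((1 : ℝ) / 2)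

end

section DirDeriv

variable {E : Type*} [NormedAddCommGroup E] [NormedSpace ℝ E]

/-- The iterated derivative of `f` in the directions of a list, the head being applied last. -/
noncomputable def dirDeriv : List E → (E → ℝ) → E → ℝ
  | [], f => f
  | e :: l, f => fun z => lineDeriv ℝ (dirDeriv l f) z e

lemma dirDeriv_append (l l' : List E) (f : E → ℝ) :
    dirDeriv (l ++ l') f = dirDeriv l (dirDeriv l' f) := by
  induction l with
  | nil => rfl
  | cons e l ih => simp only [List.cons_append, dirDeriv, ih]

lemma dirDeriv_replicate (k : ℕ) (e : E) (f : E → ℝ) :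
    dirDeriv (List.replicate k e) f = (fun (h : E → ℝ) (z : E) => lineDeriv ℝ h z e)^[k] f := by
  induction k with
  | zero => rfl
  | succ k ih => rw [List.replicate_succ, dirDeriv, ih, Function.iterate_succ_apply']

/-- The coordinate directions of `∂^α`. -/
def multiDirs {n : ℕ} {F : Type*} (e : Fin n → F) (α : Fin n → ℕ) : List F :=
  (List.finRange n).flatMap fun i => List.replicate (α i) (e i)

lemma multiDeriv_eq_dirDeriv {n : ℕ} (e : Fin n → E) (α : Fin n → ℕ) (f : E → ℝ) :
    multiDeriv e α f = dirDeriv (multiDirs e α) f := by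
  unfold multiDeriv multiDirs
  induction List.finRange n with
  | nil => rfl
  | cons i l ih =>
    rw [List.foldr_cons, ih, List.flatMap_cons, dirDeriv_append, dirDeriv_replicate]

lemma length_multiDirs {n : ℕ} {F : Type*} (e : Fin n → F) (α : Fin n → ℕ) :
    (multiDirs e α).length = multiLength α := by
  simp [multiDirs, multiLength, List.length_flatMap, Fin.sum_univ_def]

lemma map_multiDirs {n : ℕ} {F G : Type*} (g : F → G) (e : Fin n → F) (α : Fin n → ℕ) :
    (multiDirs e α).map g = multiDirs (fun i => g (e i)) α := by
  simp [multiDirs, List.map_flatMap]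

/-- The coordinate directions of `∂^α` in `ℝⁿ`. -/
noncomputable def coordDirs {n : ℕ} (α : Fin n → ℕ) : List (Rn n) :=
  multiDirs (fun i => EuclideanSpace.single i (1 : ℝ)) α

lemma length_coordDirs {n : ℕ} (α : Fin n → ℕ) : (coordDirs α).length = multiLength α :=
  length_multiDirs _ _

/-- Directions in a product, the first list acting on the first variable. -/
def prodDirs {F G : Type*} [Zero F] [Zero G] (l : List F) (l' : List G) : List (F × G) :=
  l.map (fun v => (v, 0)) ++ l'.map (fun v => (0, v))

lemma length_prodDirs {F G : Type*} [Zero F] [Zero G] (l : List F) (l' : List G) :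
    (prodDirs l l').length = l.length + l'.length := by
  simp [prodDirs]

lemma mixedDeriv_eq_dirDeriv {n : ℕ} (α β : Fin n → ℕ) (f : Rn n × Rn n → ℝ) :
    mixedDeriv α β f = dirDeriv (prodDirs (coordDirs α) (coordDirs β)) f := by
  simp only [mixedDeriv, multiDeriv_eq_dirDeriv, prodDirs, dirDeriv_append, coordDirs,
    map_multiDirs]

lemma dirDeriv_map_smul (c : ℝ) (l : List E) (f : E → ℝ) (z : E) :
    dirDeriv (l.map fun e => c • e) f z = c ^ l.length * dirDeriv l f z := by
  induction l generalizing z with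
  | nil => simp [dirDeriv]
  | cons e l ih =>
    have h : dirDeriv (l.map fun e => c • e) f = fun z => c ^ l.length * dirDeriv l f z := by
      ext z; exact ih z
    simp only [List.map_cons, dirDeriv, h, lineDeriv_smul, List.length_cons, smul_eq_mul]
    simp only [lineDeriv, deriv_const_mul_field]
    ring

lemma dirDeriv_congr {f g : E → ℝ} {W : Set E} (hW : IsOpen W) (h : EqOn f g W) (l : List E) :
    EqOn (dirDeriv l f) (dirDeriv l g) W := by
  induction l with
  | nil => exact h
  | cons e l ih =>
    intro z hz
    exact Filter.EventuallyEq.lineDeriv_eq (Filter.eventuallyEq_of_mem (hW.mem_nhds hz) ih)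

lemma eqOn_lineDeriv_fderiv {f : E → ℝ} {W : Set E} (hW : IsOpen W) (hf : DifferentiableOn ℝ f W)
    (e : E) : EqOn (fun z => lineDeriv ℝ f z e) (fun z => fderiv ℝ f z e) W := fun z hz =>
  ((hf z hz).differentiableAt (hW.mem_nhds hz)).lineDeriv_eq_fderiv

lemma contDiffOn_lineDeriv {f : E → ℝ} {W : Set E} (hW : IsOpen W) {k : ℕ}
    (hf : ContDiffOn ℝ ((k + 1 : ℕ) : ℕ∞ω) f W) (e : E) :
    ContDiffOn ℝ k (fun z => lineDeriv ℝ f z e) W := by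
  refine ContDiffOn.congr ?_ (eqOn_lineDeriv_fderiv hW (hf.differentiableOn (by simp)) e)
  exact (hf.fderiv_of_isOpen hW (by norm_cast)).clm_apply contDiffOn_const

lemma contDiffOn_dirDeriv {f : E → ℝ} {W : Set E} (hW : IsOpen W) (l : List E) {k : ℕ}
    (hf : ContDiffOn ℝ ((k + l.length : ℕ) : ℕ∞ω) f W) :
    ContDiffOn ℝ k (dirDeriv l f) W := by
  induction l generalizing k with
  | nil => simpa [dirDeriv] using hf
  | cons e l ih =>
    refine contDiffOn_lineDeriv hW (ih (k := k + 1) ?_) e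
    convert hf using 2
    simp only [List.length_cons]; ring

lemma dirDeriv_eq_iteratedFDeriv {f : E → ℝ} {W : Set E} (hW : IsOpen W) (l : List E)
    (hf : ContDiffOn ℝ l.length f W) {z : E} (hz : z ∈ W) :
    dirDeriv l f z = iteratedFDeriv ℝ l.length f z l.get := by
  induction l generalizing z with
  | nil => simp [dirDeriv]
  | cons e l ih =>
    have hf' : ContDiffOn ℝ l.length f W :=
      hf.of_le (by simp only [List.length_cons]; exact_mod_cast Nat.le_succ _)
    have h1 : (fun z => dirDeriv l f z) =ᶠ[nhds z]
        fun z => iteratedFDeriv ℝ l.length f z l.get :=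
      Filter.eventuallyEq_of_mem (hW.mem_nhds hz) fun y hy => ih hf' hy
    have hd : DifferentiableAt ℝ (iteratedFDeriv ℝ l.length f) z :=
      (hf.contDiffAt (hW.mem_nhds hz)).differentiableAt_iteratedFDeriv
        (by simp only [List.length_cons]; exact_mod_cast Nat.lt_succ_self _)
    change lineDeriv ℝ (dirDeriv l f) z e = _
    rw [Filter.EventuallyEq.lineDeriv_eq h1]
    have h2 : HasFDerivAt (fun z => iteratedFDeriv ℝ l.length f z l.get)
        ((ContinuousMultilinearMap.apply ℝ (fun _ : Fin l.length => E) ℝ l.get).comp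
          (fderiv ℝ (iteratedFDeriv ℝ l.length f) z)) z :=
      (ContinuousMultilinearMap.apply ℝ (fun _ : Fin l.length => E) ℝ l.get).hasFDerivAt.comp z
        hd.hasFDerivAt
    rw [(h2.hasLineDerivAt e).lineDeriv]
    exact (iteratedFDeriv_succ_apply_left (n := l.length) (f := f) (x := z) (e :: l).get).symm

lemma abs_dirDeriv_le {f : E → ℝ} {W : Set E} (hW : IsOpen W) (l : List E)
    (hf : ContDiffOn ℝ l.length f W) {z : E} (hz : z ∈ W) :
    |dirDeriv l f z| ≤ ‖iteratedFDeriv ℝ l.length f z‖ * (l.map fun e => ‖e‖).prod := by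
  rw [dirDeriv_eq_iteratedFDeriv hW l hf hz, ← Real.norm_eq_abs]
  refine (ContinuousMultilinearMap.le_opNorm _ _).trans_eq ?_
  congr 1
  rw [← List.prod_ofFn]
  congr 1
  conv_rhs => rw [← List.ofFn_get l]
  simp

lemma dirDeriv_perm {f : E → ℝ} {W : Set E} (hW : IsOpen W) {l l' : List E} (h : l.Perm l')
    (hf : ContDiffOn ℝ l.length f W) : EqOn (dirDeriv l f) (dirDeriv l' f) W := by
  induction h with
  | nil => exact fun z _ => rfl
  | cons e h ih =>
    have := ih (hf.of_le (by simp only [List.length_cons]; exact_mod_cast Nat.le_succ _))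
    exact dirDeriv_congr hW this [e]
  | swap a b l =>
    intro z hz
    have h2 : ContDiffOn ℝ 2 (dirDeriv l f) W := by
      refine contDiffOn_dirDeriv hW l (k := 2) (hf.of_le ?_)
      simp only [List.length_cons]; norm_cast; omega
    set g := dirDeriv l f
    have h1 : DifferentiableOn ℝ g W := h2.differentiableOn (by norm_num)
    have hd : DifferentiableAt ℝ (fderiv ℝ g) z :=
      ((h2.fderiv_of_isOpen hW (m := 1) (by norm_num)).differentiableOn (by norm_num) z
        hz).differentiableAt (hW.mem_nhds hz)
    have key : ∀ a b : E, dirDeriv [a, b] g z = fderiv ℝ (fderiv ℝ g) z a b := by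
      intro a b
      change lineDeriv ℝ (fun z => lineDeriv ℝ g z b) z a = _
      rw [Filter.EventuallyEq.lineDeriv_eq (Filter.eventuallyEq_of_mem (hW.mem_nhds hz)
        (eqOn_lineDeriv_fderiv hW h1 b))]
      have h3 : HasFDerivAt (fun z => fderiv ℝ g z b)
          ((ContinuousLinearMap.apply ℝ ℝ b).comp (fderiv ℝ (fderiv ℝ g) z)) z :=
        (ContinuousLinearMap.apply ℝ ℝ b).hasFDerivAt.comp z hd.hasFDerivAt
      rw [(h3.hasLineDerivAt a).lineDeriv]
      rfl
    change dirDeriv [b, a] g z = dirDeriv [a, b] g z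
    rw [key, key]
    exact ((h2.contDiffAt (hW.mem_nhds hz)).isSymmSndFDerivAt (by simp)).eq b a
  | trans h1 _ ih1 ih2 =>
    exact (ih1 hf).trans (ih2 (h1.length_eq ▸ hf))

/-- The iterated difference of `f` with steps in a list. -/
def finDiff : List E → (E → ℝ) → E → ℝ
  | [], f, z => f z
  | e :: l, f, z => finDiff l f (z + e) - finDiff l f z

/-- The points `z + ∑ tᵢ eᵢ` with `tᵢ ∈ [0, 1]`. -/
def zonotope : List E → E → Set E
  | [], z => {z}
  | e :: l, z => ⋃ t ∈ Icc (0 : ℝ) 1, zonotope l (z + t • e)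

lemma zonotope_subset_cons {e : E} {l : List E} {z : E} {t : ℝ} (ht : t ∈ Icc (0 : ℝ) 1) :
    zonotope l (z + t • e) ⊆ zonotope (e :: l) z := fun _ hw =>
  mem_biUnion (t := fun t : ℝ => zonotope l (z + t • e)) ht hw

lemma hasLineDerivAt_finDiff {f : E → ℝ} {W : Set E} (hf : ∀ z ∈ W, DifferentiableAt ℝ f z) (v : E)
    (l : List E) (z : E) (hz : zonotope l z ⊆ W) :
    HasLineDerivAt ℝ (finDiff l f) (finDiff l (fun z => lineDeriv ℝ f z v) z) z v := by
  induction l generalizing z with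
  | nil => exact (hf z (hz rfl)).lineDifferentiableAt.hasLineDerivAt
  | cons e l ih =>
    have h1 := ih (z + e) (by simpa using (zonotope_subset_cons (t := 1) (by simp)).trans hz)
    have h0 := ih z (by simpa using (zonotope_subset_cons (t := 0) (by simp)).trans hz)
    unfold HasLineDerivAt at *
    have h2 := h1.sub h0
    simp only [add_right_comm z e] at h2
    exact h2

theorem exists_finDiff_eq_dirDeriv {W : Set E} (hW : IsOpen W) (l : List E) {f : E → ℝ}
    (hf : ContDiffOn ℝ l.length f W) (z : E) (hz : zonotope l z ⊆ W) :
    ∃ w ∈ zonotope l z, finDiff l f z = dirDeriv l.reverse f w := by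
  induction l generalizing f z with
  | nil => exact ⟨z, rfl, rfl⟩
  | cons e l ih =>
    have hf1 : ∀ z ∈ W, DifferentiableAt ℝ f z := fun z hz =>
      (hf.differentiableOn (by simp) z hz).differentiableAt (hW.mem_nhds hz)
    have hder : ∀ s ∈ Icc (0 : ℝ) 1, HasDerivAt (fun s : ℝ => finDiff l f (z + s • e))
        (finDiff l (fun z => lineDeriv ℝ f z e) (z + s • e)) s := by
      intro s hs
      have h1 := hasLineDerivAt_finDiff hf1 e l (z + s • e) ((zonotope_subset_cons hs).trans hz)
      unfold HasLineDerivAt at h1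
      have h2 := HasDerivAt.comp_sub_const (x := s) (a := s) (f' := finDiff l (fun z =>
        lineDeriv ℝ f z e) (z + s • e)) (by simpa using h1)
      refine h2.congr_of_eventuallyEq (Filter.Eventually.of_forall fun t => ?_)
      simp only
      rw [add_assoc, ← add_smul]; simp
    obtain ⟨s, hs, hs'⟩ := exists_hasDerivAt_eq_slope (fun s : ℝ => finDiff l f (z + s • e)) _
      one_pos (fun s hs => (hder s hs).continuousAt.continuousWithinAt)
      (fun s hs => hder s (Ioo_subset_Icc_self hs))
    have hs2 := Ioo_subset_Icc_self hs
    obtain ⟨w, hw, hw'⟩ := ih (contDiffOn_lineDeriv hW hf e) (z + s • e)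
      ((zonotope_subset_cons hs2).trans hz)
    refine ⟨w, zonotope_subset_cons hs2 hw, ?_⟩
    rw [List.reverse_cons, dirDeriv_append]
    change _ = dirDeriv l.reverse (fun z => lineDeriv ℝ f z e) w
    rw [← hw', hs']
    simp [finDiff]

lemma zonotope_subset_closedBall (l : List E) (z : E) :
    zonotope l z ⊆ Metric.closedBall z (l.map fun e => ‖e‖).sum := by
  induction l generalizing z with
  | nil => simp [zonotope]
  | cons e l ih =>
    refine iUnion₂_subset fun t ht => (ih _).trans ?_
    refine Metric.closedBall_subset_closedBall' ?_
    have : ‖t • e‖ ≤ ‖e‖ := by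
      rw [norm_smul, Real.norm_of_nonneg ht.1]
      exact mul_le_of_le_one_left (norm_nonneg _) ht.2
    simp only [List.map_cons, List.sum_cons, dist_eq_norm, add_sub_cancel_left]
    linarith

theorem tendsto_finDiff {W : Set E} (hW : IsOpen W) (l : List E) {f : E → ℝ}
    (hf : ContDiffOn ℝ l.length f W) {z : E} (hz : z ∈ W) :
    Filter.Tendsto (fun h : ℝ => finDiff (l.map fun e => h • e) f z / h ^ l.length)
      (nhdsWithin 0 (Ioi 0)) (nhds (dirDeriv l f z)) := by
  obtain ⟨r, hr, hrW⟩ := Metric.isOpen_iff.1 hW z hz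
  set S := (l.map fun e => ‖e‖).sum with hS
  have hS0 : 0 ≤ S := List.sum_nonneg (by simp)
  have hc : ContinuousAt (dirDeriv l f) z :=
    ((contDiffOn_dirDeriv hW l (k := 0) (by simpa using hf)).continuousOn z hz).continuousAt
      (hW.mem_nhds hz)
  rw [Metric.tendsto_nhds]
  intro ε hε
  obtain ⟨δ, hδ, hδ'⟩ := Metric.continuousAt_iff.1 hc ε hε
  have hpos : 0 < min r δ / (S + 1) := by positivity
  filter_upwards [Ioo_mem_nhdsGT hpos] with h hh
  have hball : zonotope (l.map fun e => h • e) z ⊆ Metric.ball z (min r δ) := by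
    refine (zonotope_subset_closedBall _ _).trans (Metric.closedBall_subset_ball ?_)
    have : (List.map (fun e => ‖e‖) (List.map (fun e => h • e) l)).sum = h * S := by
      rw [hS, List.map_map, ← List.sum_map_mul_left]
      congr 1
      refine List.map_congr_left fun e _ => ?_
      simp [norm_smul, abs_of_pos hh.1]
    rw [this]
    have h2 := (lt_div_iff₀ (by positivity)).1 hh.2
    nlinarith [hh.1]
  obtain ⟨w, hw, hw'⟩ := exists_finDiff_eq_dirDeriv hW (l.map fun e => h • e) (f := f)
    (by simpa using hf) z (hball.trans ((Metric.ball_subset_ball (min_le_left _ _)).trans hrW))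
  have hwW : w ∈ W := hrW (Metric.ball_subset_ball (min_le_left _ _) (hball hw))
  rw [hw', ← List.map_reverse, dirDeriv_map_smul, List.length_reverse,
    mul_div_cancel_left₀ _ (pow_ne_zero _ hh.1.ne'),
    dirDeriv_perm hW (List.reverse_perm l) (by simpa using hf) hwW]
  exact hδ' (Metric.ball_subset_ball (min_le_right _ _) (hball hw))

lemma tsupport_lineDeriv_subset {ψ : E → ℝ} (hψ : Differentiable ℝ ψ) (e : E) :
    tsupport (fun z => lineDeriv ℝ ψ z e) ⊆ tsupport ψ := by
  have : (fun z => lineDeriv ℝ ψ z e) = fun z => fderiv ℝ ψ z e := by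
    ext z; exact (hψ z).lineDeriv_eq_fderiv
  rw [this]
  exact tsupport_fderiv_apply_subset ℝ e

lemma contDiff_lineDeriv {ψ : E → ℝ} (hψ : ContDiff ℝ ∞ ψ) (e : E) :
    ContDiff ℝ ∞ (fun z => lineDeriv ℝ ψ z e) := by
  have : (fun z => lineDeriv ℝ ψ z e) = fun z => fderiv ℝ ψ z e := by
    ext z; exact (hψ.differentiable (by simp) z).lineDeriv_eq_fderiv
  rw [this]
  exact (hψ.fderiv_right (by simp)).clm_apply contDiff_const

lemma contDiff_dirDeriv {ψ : E → ℝ} (hψ : ContDiff ℝ ∞ ψ) (l : List E) :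
    ContDiff ℝ ∞ (dirDeriv l ψ) := by
  induction l with
  | nil => exact hψ
  | cons e l ih => exact contDiff_lineDeriv ih e

lemma tsupport_dirDeriv_subset {ψ : E → ℝ} (hψ : ContDiff ℝ ∞ ψ) (l : List E) :
    tsupport (dirDeriv l ψ) ⊆ tsupport ψ := by
  induction l with
  | nil => exact subset_rfl
  | cons e l ih =>
    exact (tsupport_lineDeriv_subset ((contDiff_dirDeriv hψ l).differentiable (by simp)) e).trans ih

lemma continuous_mul_of_tsupport_subset {X : Type*} [TopologicalSpace X] {f g : X → ℝ} {W : Set X}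
    (hW : IsOpen W)
    (hf : ContinuousOn f W) (hg : Continuous g) (hs : tsupport g ⊆ W) :
    Continuous fun z => f z * g z := by
  refine continuous_of_tsupport fun z hz => ?_
  have hz' : z ∈ W := hs (tsupport_mul_subset_right hz)
  exact (hf.continuousAt (hW.mem_nhds hz')).mul hg.continuousAt

variable [FiniteDimensional ℝ E] [MeasurableSpace E] [BorelSpace E]

lemma integral_mul_lineDeriv_eq {ν : Measure E} [ν.IsAddHaarMeasure] {f ψ : E → ℝ} {W : Set E}
    (hW : IsOpen W) (hf : ContDiffOn ℝ 1 f W) (hψ : ContDiff ℝ ∞ ψ) (hc : HasCompactSupport ψ)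
    (hs : tsupport ψ ⊆ W) (e : E) :
    ∫ z, f z * lineDeriv ℝ ψ z e ∂ν = -∫ z, lineDeriv ℝ f z e * ψ z ∂ν := by
  have h1 : ∀ z, lineDeriv ℝ ψ z e = fderiv ℝ ψ z e := fun z =>
    (hψ.differentiable (by simp) z).lineDeriv_eq_fderiv
  have hfd : ∀ z ∈ W, DifferentiableAt ℝ f z := fun z hz =>
    (hf.differentiableOn (by simp) z hz).differentiableAt (hW.mem_nhds hz)
  have h2 : (fun z => lineDeriv ℝ f z e * ψ z) = fun z => fderiv ℝ f z e * ψ z := by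
    ext z
    by_cases hz : z ∈ W
    · rw [(hfd z hz).lineDeriv_eq_fderiv]
    · rw [image_eq_zero_of_notMem_tsupport (fun h => hz (hs h)), mul_zero, mul_zero]
  simp only [h1, h2]
  refine integral_mul_fderiv_eq_neg_fderiv_mul_of_integrable ?_ ?_ ?_ (fun z hz => hfd z (hs hz))
    (fun z _ => hψ.differentiable (by simp) z)
  · refine (continuous_mul_of_tsupport_subset hW ?_ hψ.continuous hs).integrable_of_hasCompactSupport
      hc.mul_left
    exact (hf.fderiv_of_isOpen hW (m := 0) (by norm_num)).continuousOn.clm_apply continuousOn_const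
  · refine (continuous_mul_of_tsupport_subset hW hf.continuousOn ?_
      ((tsupport_fderiv_apply_subset ℝ e).trans hs)).integrable_of_hasCompactSupport
      (hc.fderiv_apply ℝ e).mul_left
    exact ((hψ.fderiv_right (m := 0) (by simp)).clm_apply contDiff_const).continuous
  · exact (continuous_mul_of_tsupport_subset hW hf.continuousOn hψ.continuous
      hs).integrable_of_hasCompactSupport hc.mul_left

theorem integral_mul_dirDeriv_eq {ν : Measure E} [ν.IsAddHaarMeasure] {f ψ : E → ℝ} {W : Set E}
    (hW : IsOpen W) (l : List E) (hf : ContDiffOn ℝ l.length f W) (hψ : ContDiff ℝ ∞ ψ)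
    (hc : HasCompactSupport ψ) (hs : tsupport ψ ⊆ W) :
    ∫ z, f z * dirDeriv l ψ z ∂ν = (-1) ^ l.length * ∫ z, dirDeriv l f z * ψ z ∂ν := by
  suffices h : ∫ z, f z * dirDeriv l ψ z ∂ν =
      (-1) ^ l.length * ∫ z, dirDeriv l.reverse f z * ψ z ∂ν by
    rw [h]
    congr 2
    ext z
    by_cases hz : z ∈ W
    · rw [dirDeriv_perm hW (List.reverse_perm l) (by simpa using hf) hz]
    · rw [image_eq_zero_of_notMem_tsupport (fun h => hz (hs h)), mul_zero, mul_zero]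
  induction l generalizing f with
  | nil => simp [dirDeriv]
  | cons e l ih =>
    have hc' : HasCompactSupport (dirDeriv l ψ) :=
      hc.of_isClosed_subset (isClosed_tsupport _) (tsupport_dirDeriv_subset hψ l)
    change ∫ z, f z * lineDeriv ℝ (dirDeriv l ψ) z e ∂ν = _
    rw [integral_mul_lineDeriv_eq hW (hf.of_le (by simp)) (contDiff_dirDeriv hψ l) hc'
      ((tsupport_dirDeriv_subset hψ l).trans hs) e, ih (contDiffOn_lineDeriv hW hf e),
      List.reverse_cons, dirDeriv_append, List.length_cons, pow_succ]
    simp only [dirDeriv]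
    ring

end DirDeriv

instance {n : ℕ} : (volume : Measure (Rn n × Rn n)).IsAddHaarMeasure :=
  inferInstanceAs (volume.prod volume : Measure (Rn n × Rn n)).IsAddHaarMeasure

theorem isWeakMixedDeriv_mixedDeriv {n : ℕ} {Ω : Set (Rn n)} {α β : Fin n → ℕ}
    {u : Rn n × Rn n → ℝ}
    (hu : ContDiffOn ℝ ((multiLength α + multiLength β : ℕ) : ℕ∞ω) u (interior (Ω ×ˢ Ω))) :
    IsWeakMixedDeriv Ω α β u (mixedDeriv α β u) := by
  intro ψ hψ hc hs
  have hlen : (prodDirs (coordDirs α) (coordDirs β)).length = multiLength α + multiLength β := by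
    rw [length_prodDirs, length_coordDirs, length_coordDirs]
  have hzero : ∀ g : Rn n × Rn n → ℝ, tsupport g ⊆ tsupport ψ → ∀ z ∉ Ω ×ˢ Ω, g z = 0 :=
    fun g hg z hz => image_eq_zero_of_notMem_tsupport fun h =>
      hz (interior_subset (hs (hg h)))
  simp only [mixedDeriv_eq_dirDeriv]
  rw [setIntegral_eq_integral_of_forall_compl_eq_zero, setIntegral_eq_integral_of_forall_compl_eq_zero,
    integral_mul_dirDeriv_eq isOpen_interior _ (hlen ▸ hu) hψ hc hs, hlen]
  · intro z hz
    rw [hzero ψ subset_rfl z hz, mul_zero]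
  · intro z hz
    rw [hzero _ (tsupport_dirDeriv_subset hψ _) z hz, mul_zero]

section KernelForm

variable {X : Type*}

/-- The bilinear form `∑ L(x) L'(y) K(x, y)` on finitely supported functions. -/
noncomputable def kernelForm (K : X × X → ℝ) (L L' : X →₀ ℝ) : ℝ :=
  Finsupp.linearCombination ℝ (fun x => Finsupp.linearCombination ℝ (fun y => K (x, y)) L') L

variable (K : X × X → ℝ) (L L₁ L₂ : X →₀ ℝ)

lemma kernelForm_add_left : kernelForm K (L₁ + L₂) L = kernelForm K L₁ L + kernelForm K L₂ L :=
  map_add _ _ _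

lemma kernelForm_sub_left : kernelForm K (L₁ - L₂) L = kernelForm K L₁ L - kernelForm K L₂ L :=
  map_sub _ _ _

lemma kernelForm_smul_left (c : ℝ) : kernelForm K (c • L₁) L = c * kernelForm K L₁ L :=
  map_smul _ _ _

lemma kernelForm_eq_sum : kernelForm K L₁ L₂ =
    ∑ x ∈ L₁.support, ∑ y ∈ L₂.support, L₁ x * L₂ y * K (x, y) := by
  simp only [kernelForm, Finsupp.linearCombination_apply, Finsupp.sum, smul_eq_mul, Finset.mul_sum,
    mul_assoc]

lemma kernelForm_swap : kernelForm K L₁ L₂ = kernelForm (fun z => K z.swap) L₂ L₁ := by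
  rw [kernelForm_eq_sum, kernelForm_eq_sum, Finset.sum_comm]
  simp only [Prod.swap, mul_comm]

lemma kernelForm_add_right : kernelForm K L (L₁ + L₂) = kernelForm K L L₁ + kernelForm K L L₂ := by
  rw [kernelForm_swap, kernelForm_add_left, ← kernelForm_swap, ← kernelForm_swap]

lemma kernelForm_sub_right : kernelForm K L (L₁ - L₂) = kernelForm K L L₁ - kernelForm K L L₂ := by
  rw [kernelForm_swap, kernelForm_sub_left, ← kernelForm_swap, ← kernelForm_swap]

lemma kernelForm_smul_right (c : ℝ) : kernelForm K L (c • L₁) = c * kernelForm K L L₁ := by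
  rw [kernelForm_swap, kernelForm_smul_left, ← kernelForm_swap]

lemma kernelForm_single (x y : X) (a b : ℝ) :
    kernelForm K (Finsupp.single x a) (Finsupp.single y b) = a * (b * K (x, y)) := by
  simp [kernelForm]

/-- `R` is a symmetric positive semidefinite kernel on `Ω`. -/
structure IsPSDKernelOn (Ω : Set X) (R : X × X → ℝ) : Prop where
  symm : ∀ x ∈ Ω, ∀ y ∈ Ω, R (x, y) = R (y, x)
  nonneg : ∀ L : X →₀ ℝ, (L.support : Set X) ⊆ Ω → 0 ≤ kernelForm R L L

variable {Ω : Set X} {R : X × X → ℝ} {K L L₁ L₂}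

lemma support_add_subset {Ω : Set X} (h₁ : (L₁.support : Set X) ⊆ Ω)
    (h₂ : (L₂.support : Set X) ⊆ Ω) : ((L₁ + L₂).support : Set X) ⊆ Ω := by
  classical
  exact fun x hx => (Finset.mem_union.1 (Finsupp.support_add hx)).elim (@h₁ x) (@h₂ x)

lemma support_smul_subset {Ω : Set X} (c : ℝ) (h : (L.support : Set X) ⊆ Ω) :
    ((c • L).support : Set X) ⊆ Ω := fun _ hx => h (Finsupp.support_smul hx)

lemma support_sub_subset {Ω : Set X} (h₁ : (L₁.support : Set X) ⊆ Ω)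
    (h₂ : (L₂.support : Set X) ⊆ Ω) : ((L₁ - L₂).support : Set X) ⊆ Ω := by
  rw [sub_eq_add_neg, ← neg_one_smul ℝ L₂]
  exact support_add_subset h₁ (support_smul_subset _ h₂)

lemma support_single_subset {x : X} (hx : x ∈ Ω) (a : ℝ) :
    ((Finsupp.single x a).support : Set X) ⊆ Ω := fun y hy => by
  have := Finsupp.support_single_subset hy
  simp only [Finset.mem_singleton] at this
  exact this ▸ hx

namespace IsPSDKernelOn

lemma form_comm (hR : IsPSDKernelOn Ω R) (h₁ : (L₁.support : Set X) ⊆ Ω)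
    (h₂ : (L₂.support : Set X) ⊆ Ω) : kernelForm R L₁ L₂ = kernelForm R L₂ L₁ := by
  rw [kernelForm_eq_sum, kernelForm_eq_sum, Finset.sum_comm]
  refine Finset.sum_congr rfl fun y hy => Finset.sum_congr rfl fun x hx => ?_
  rw [hR.symm x (h₁ hx) y (h₂ hy), mul_comm (L₁ x)]

theorem form_sq_le (hR : IsPSDKernelOn Ω R) (h₁ : (L₁.support : Set X) ⊆ Ω)
    (h₂ : (L₂.support : Set X) ⊆ Ω) :
    kernelForm R L₁ L₂ ^ 2 ≤ kernelForm R L₁ L₁ * kernelForm R L₂ L₂ := by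
  have h : ∀ t : ℝ, 0 ≤ kernelForm R L₂ L₂ * (t * t) + 2 * kernelForm R L₁ L₂ * t +
      kernelForm R L₁ L₁ := by
    intro t
    have := hR.nonneg (L₁ + t • L₂) (support_add_subset h₁ (support_smul_subset t h₂))
    rw [kernelForm_add_left, kernelForm_add_right, kernelForm_add_right, kernelForm_smul_left,
      kernelForm_smul_left, kernelForm_smul_right, kernelForm_smul_right,
      hR.form_comm h₂ h₁] at this
    linarith
  have := discrim_le_zero h
  unfold discrim at this
  linarith

lemma sq_le (hR : IsPSDKernelOn Ω R) {x y : X} (hx : x ∈ Ω) (hy : y ∈ Ω) :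
    R (x, y) ^ 2 ≤ R (x, x) * R (y, y) := by
  simpa [kernelForm_single] using
    hR.form_sq_le (support_single_subset hx 1) (support_single_subset hy 1)

lemma diag_nonneg (hR : IsPSDKernelOn Ω R) {x : X} (hx : x ∈ Ω) : 0 ≤ R (x, x) := by
  simpa [kernelForm_single] using hR.nonneg _ (support_single_subset hx 1)

end IsPSDKernelOn

end KernelForm

lemma IsMercerKernel.isPSDKernelOn {n : ℕ} {Ω : Set (Rn n)} {K : Rn n × Rn n → ℝ}
    (hK : IsMercerKernel Ω K) : IsPSDKernelOn Ω K where
  symm := hK.symm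
  nonneg L hL := by
    rw [kernelForm_eq_sum]
    exact hK.nonneg L.support hL L

section DiffFunctional

variable {E : Type*} [NormedAddCommGroup E] [NormedSpace ℝ E]

/-- The iterated difference with steps in a list, as a finitely supported functional. -/
noncomputable def diffFunctional : List E → E → E →₀ ℝ
  | [], x => Finsupp.single x 1
  | e :: l, x => diffFunctional l (x + e) - diffFunctional l x

lemma support_diffFunctional (l : List E) (x : E) :
    ((diffFunctional l x).support : Set E) ⊆ zonotope l x := by
  induction l generalizing x with
  | nil => exact support_single_subset (mem_singleton x) 1
  | cons e l ih =>
    refine support_sub_subset ((ih _).trans ?_) ((ih _).trans ?_)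
    · simpa using zonotope_subset_cons (e := e) (l := l) (z := x) (t := 1) (by simp)
    · simpa using zonotope_subset_cons (e := e) (l := l) (z := x) (t := 0) (by simp)

lemma finDiff_eq_kernelForm (K : E × E → ℝ) (l l' : List E) (x y : E) :
    finDiff (prodDirs l l') K (x, y) =
      kernelForm K (diffFunctional l x) (diffFunctional l' y) := by
  induction l generalizing x with
  | nil =>
    induction l' generalizing y with
    | nil => simp [prodDirs, finDiff, diffFunctional, kernelForm_single]
    | cons e l' ih =>
      rw [show diffFunctional (e :: l') y = diffFunctional l' (y + e) - diffFunctional l' y from rfl,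
        kernelForm_sub_right, ← ih, ← ih]
      simp [prodDirs, finDiff]
  | cons e l ih =>
    rw [diffFunctional, kernelForm_sub_left, ← ih, ← ih]
    simp [prodDirs, finDiff]

lemma zonotope_prodDirs_subset (l l' : List E) (x y : E) :
    zonotope (prodDirs l l') (x, y) ⊆ zonotope l x ×ˢ zonotope l' y := by
  induction l generalizing x with
  | nil =>
    induction l' generalizing y with
    | nil => simp [prodDirs, zonotope]
    | cons e l' ih =>
      refine iUnion₂_subset fun t ht => ?_
      have := ih (y + t • e)
      simp only [Prod.mk_add_mk, Prod.smul_mk, smul_zero, add_zero]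
      exact this.trans (prod_mono subset_rfl (zonotope_subset_cons ht))
  | cons e l ih =>
    refine iUnion₂_subset fun t ht => ?_
    have := ih (x + t • e)
    simp only [Prod.mk_add_mk, Prod.smul_mk, smul_zero, add_zero]
    exact this.trans (prod_mono (zonotope_subset_cons ht) subset_rfl)

lemma zonotope_replicate_subset (k : ℕ) (h x : E) :
    zonotope (List.replicate k h) x ⊆ (fun s : ℝ => x + s • h) '' Icc 0 k := by
  induction k generalizing x with
  | zero => simp [zonotope]
  | succ k ih =>
    refine iUnion₂_subset fun t ht => (ih _).trans ?_
    rintro _ ⟨s, hs, rfl⟩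
    refine ⟨t + s, ⟨add_nonneg ht.1 hs.1, ?_⟩, ?_⟩
    · push_cast
      linarith [ht.2, hs.2]
    · simp only [add_smul, add_assoc]

lemma exists_diffFunctional_replicate_eq (k : ℕ) : ∃ c : ℕ → ℝ, ∀ h x : E,
    diffFunctional (List.replicate k h) x = (-1 : ℝ) ^ k • Finsupp.single x 1 +
      ∑ j ∈ Finset.range k, c j • Finsupp.single (x + ((j + 1 : ℕ) : ℝ) • h) 1 := by
  induction k with
  | zero => exact ⟨0, fun h x => by simp [diffFunctional]⟩
  | succ k ih =>
    obtain ⟨c, hc⟩ := ih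
    refine ⟨fun j => (if j = 0 then (-1) ^ k else c (j - 1)) - if j < k then c j else 0,
      fun h x => ?_⟩
    rw [List.replicate_succ, diffFunctional, hc, hc]
    simp only [sub_smul, Finset.sum_sub_distrib]
    rw [Finset.sum_range_succ', Finset.sum_range_succ (n := k)]
    have h1 : ∑ j ∈ Finset.range k, (if j < k then c j else 0) •
        Finsupp.single (x + ((j + 1 : ℕ) : ℝ) • h) (1 : ℝ) =
        ∑ j ∈ Finset.range k, c j • Finsupp.single (x + ((j + 1 : ℕ) : ℝ) • h) 1 :=
      Finset.sum_congr rfl fun j hj => by rw [if_pos (Finset.mem_range.1 hj)]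
    have h2 : ∀ j : ℕ, x + h + ((j + 1 : ℕ) : ℝ) • h = x + ((j + 1 + 1 : ℕ) : ℝ) • h := by
      intro j
      push_cast
      module
    rw [h1]
    simp only [h2, pow_succ]
    simp
    abel

end DiffFunctional

section IntegralForm

lemma integral_comp_simpleFunc_mul {X : Type*} [MeasurableSpace X] {μ : Measure X} {f : X → ℝ}
    (hf : Integrable f μ) (p : SimpleFunc X X) (g : X → ℝ) :
    ∫ y, g (p y) * f y ∂μ = Finsupp.linearCombination ℝ g
      (∑ a ∈ p.range, (∫ y in p ⁻¹' {a}, f y ∂μ) • Finsupp.single a 1) := by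
  have h1 : ∀ y, g (p y) * f y = ∑ a ∈ p.range, (p ⁻¹' {a}).indicator (fun y => g a * f y) y := by
    intro y
    rw [Finset.sum_eq_single (p y)]
    · simp
    · intro b _ hb
      rw [indicator_of_notMem]
      exact fun h => hb h.symm
    · intro h
      exact absurd (p.mem_range_self y) h
  simp only [h1]
  rw [integral_finsetSum _ fun a _ =>
    (hf.const_mul (g a)).indicator (p.measurableSet_fiber a)]
  simp only [map_sum, map_smul, Finsupp.linearCombination_single, smul_eq_mul, one_mul]
  refine Finset.sum_congr rfl fun a _ => ?_
  rw [integral_indicator (p.measurableSet_fiber a), integral_const_mul, mul_comm]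

variable {n : ℕ} {Ω : Set (Rn n)} {K : Rn n × Rn n → ℝ}

lemma exists_abs_le_of_continuousOn (hΩ : IsCompact Ω) (hK : ContinuousOn K (Ω ×ˢ Ω)) :
    ∃ C : ℝ, 0 ≤ C ∧ ∀ x ∈ Ω, ∀ y ∈ Ω, |K (x, y)| ≤ C := by
  obtain ⟨C, hC⟩ := (hΩ.prod hΩ).exists_bound_of_continuousOn hK
  exact ⟨max C 0, le_max_right _ _, fun x hx y hy =>
    (hC (x, y) ⟨hx, hy⟩).trans (le_max_left _ _)⟩

/-- The quadratic form of a Mercer kernel is nonnegative on sums of a finitely supported functional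
and an integrable density. -/
theorem kernelForm_add_integral_nonneg (hΩ : IsCompact Ω) (hne : Ω.Nonempty)
    (hc : ContinuousOn K (Ω ×ˢ Ω)) (hK : IsPSDKernelOn Ω K)
    (L : Rn n →₀ ℝ) (hL : (L.support : Set (Rn n)) ⊆ Ω) {f : Rn n → ℝ}
    (hf : IntegrableOn f Ω) :
    0 ≤ kernelForm K L L +
      2 * Finsupp.linearCombination ℝ (fun x => ∫ y in Ω, K (x, y) * f y) L +
      ∫ x in Ω, (∫ y in Ω, K (x, y) * f y) * f x := by
  obtain ⟨y₀, hy₀⟩ := hne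
  obtain ⟨C, hC0, hC⟩ := exists_abs_le_of_continuousOn hΩ hc
  let p : ℕ → SimpleFunc (Rn n) (Rn n) := SimpleFunc.approxOn id measurable_id Ω y₀ hy₀
  have hpΩ : ∀ k x, p k x ∈ Ω := fun k x => SimpleFunc.approxOn_mem _ _ k x
  have hp : ∀ x ∈ Ω, Filter.Tendsto (fun k => p k x) Filter.atTop (nhds x) := fun x hx =>
    SimpleFunc.tendsto_approxOn measurable_id hy₀ (subset_closure hx)
  have hmem : ∀ᵐ y ∂volume.restrict Ω, y ∈ Ω := ae_restrict_mem hΩ.measurableSet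
  let M : ℕ → (Rn n →₀ ℝ) := fun k =>
    ∑ a ∈ (p k).range, (∫ y in (p k) ⁻¹' {a}, f y ∂volume.restrict Ω) • Finsupp.single a 1
  have hM : ∀ k, ((M k).support : Set (Rn n)) ⊆ Ω := by
    intro k
    refine Finset.sum_induction _ (fun L : Rn n →₀ ℝ => (L.support : Set (Rn n)) ⊆ Ω)
      (fun _ _ => support_add_subset) (by simp) fun a ha => ?_
    obtain ⟨x, rfl⟩ := SimpleFunc.mem_range.1 ha
    exact support_smul_subset _ (support_single_subset (hpΩ k x) 1)
  have hLM : ∀ k, kernelForm K L (M k) =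
      Finsupp.linearCombination ℝ (fun x => ∫ y in Ω, K (x, p k y) * f y) L := by
    intro k
    simp only [kernelForm]
    congr 2
    ext x
    exact (integral_comp_simpleFunc_mul hf (p k) fun y => K (x, y)).symm
  have hMM : ∀ k, kernelForm K (M k) (M k) =
      ∫ x in Ω, (∫ y in Ω, K (p k x, p k y) * f y) * f x := by
    intro k
    rw [integral_comp_simpleFunc_mul hf (p k) fun x => ∫ y in Ω, K (x, p k y) * f y]
    simp only [kernelForm]
    congr 2
    ext x
    exact (integral_comp_simpleFunc_mul hf (p k) fun y => K (x, y)).symm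
  have hpos : ∀ k, 0 ≤ kernelForm K L L +
      2 * Finsupp.linearCombination ℝ (fun x => ∫ y in Ω, K (x, p k y) * f y) L +
      ∫ x in Ω, (∫ y in Ω, K (p k x, p k y) * f y) * f x := by
    intro k
    have := hK.nonneg (L + M k) (support_add_subset hL (hM k))
    rw [kernelForm_add_left, kernelForm_add_right, kernelForm_add_right,
      hK.form_comm (hM k) hL, hLM, hMM] at this
    linarith
  have hmeas : ∀ (g : Rn n → ℝ) k, AEStronglyMeasurable (fun y => g (p k y) * f y)
      (volume.restrict Ω) := fun g k =>
    (((p k).map g).stronglyMeasurable.aestronglyMeasurable).mul hf.aestronglyMeasurable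
  have hlim1 : ∀ x ∈ Ω, ∀ q : ℕ → Rn n, (∀ k, q k ∈ Ω) →
      Filter.Tendsto q Filter.atTop (nhds x) →
      Filter.Tendsto (fun k => ∫ y in Ω, K (q k, p k y) * f y) Filter.atTop
      (nhds (∫ y in Ω, K (x, y) * f y)) := by
    intro x hx q hq hqx
    refine tendsto_integral_of_dominated_convergence (fun y => C * |f y|)
      (fun k => hmeas (fun y => K (q k, y)) k) (hf.abs.const_mul C) ?_ ?_
    · intro k
      refine Filter.Eventually.of_forall fun y => ?_
      rw [Real.norm_eq_abs, abs_mul]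
      exact mul_le_mul_of_nonneg_right (hC _ (hq k) _ (hpΩ k y)) (abs_nonneg _)
    · filter_upwards [hmem] with y hy
      refine Filter.Tendsto.mul_const _ ?_
      refine (hc (x, y) ⟨hx, hy⟩).tendsto.comp (tendsto_nhdsWithin_iff.2 ⟨?_, ?_⟩)
      · exact hqx.prodMk_nhds (hp y hy)
      · exact Filter.Eventually.of_forall fun k => ⟨hq k, hpΩ k y⟩
  refine ge_of_tendsto' (x := Filter.atTop) (Filter.Tendsto.add (tendsto_const_nhds.add
    (Filter.Tendsto.const_mul 2 ?_)) ?_) hpos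
  · simp only [Finsupp.linearCombination_apply, Finsupp.sum]
    exact tendsto_finsetSum _ fun x hx => (hlim1 x (hL hx) (fun _ => x) (fun _ => hL hx)
      tendsto_const_nhds).const_smul _
  · refine tendsto_integral_of_dominated_convergence
      (fun x => (C * ∫ y in Ω, |f y|) * |f x|) (fun k => hmeas (fun x => ∫ y in Ω,
        K (x, p k y) * f y) k) (hf.abs.const_mul _) ?_ ?_
    · intro k
      refine Filter.Eventually.of_forall fun x => ?_
      rw [Real.norm_eq_abs, abs_mul]
      refine mul_le_mul_of_nonneg_right ?_ (abs_nonneg _)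
      rw [← integral_const_mul, ← Real.norm_eq_abs]
      refine norm_integral_le_of_norm_le (hf.abs.const_mul C) ?_
      refine Filter.Eventually.of_forall fun y => ?_
      rw [Real.norm_eq_abs, abs_mul]
      exact mul_le_mul_of_nonneg_right (hC _ (hpΩ k x) _ (hpΩ k y)) (abs_nonneg _)
    · filter_upwards [hmem] with x hx
      exact (hlim1 x hx (fun k => p k x) (fun k => hpΩ k x) (hp x hx)).mul_const _

end IntegralForm

section Residual

variable {n : ℕ} {Ω : Set (Rn n)} {K : Rn n × Rn n → ℝ} {ev : ℕ → ℝ} {φ : ℕ → Rn n → ℝ}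

/-- The remainder `K(x, y) - ∑_{i < N} λᵢ φᵢ(x) φᵢ(y)` of the Mercer expansion. -/
noncomputable def mercerResidual (K : Rn n × Rn n → ℝ) (ev : ℕ → ℝ) (φ : ℕ → Rn n → ℝ) (N : ℕ)
    (z : Rn n × Rn n) : ℝ :=
  K z - ∑ i ∈ Finset.range N, ev i * φ i z.1 * φ i z.2

lemma kernelForm_mercerResidual (K : Rn n × Rn n → ℝ) (ev : ℕ → ℝ) (φ : ℕ → Rn n → ℝ) (N : ℕ)
    (L L' : Rn n →₀ ℝ) : kernelForm (mercerResidual K ev φ N) L L' = kernelForm K L L' -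
      ∑ i ∈ Finset.range N, ev i * Finsupp.linearCombination ℝ (φ i) L *
        Finsupp.linearCombination ℝ (φ i) L' := by
  simp only [kernelForm_eq_sum, mercerResidual, mul_sub, Finset.sum_sub_distrib]
  congr 1
  simp only [Finset.mul_sum, Finsupp.linearCombination_apply, Finsupp.sum, smul_eq_mul,
    Finset.sum_mul]
  simp only [Finset.sum_comm (s := L'.support) (t := Finset.range N)]
  rw [Finset.sum_comm]
  refine Finset.sum_congr rfl fun i _ => ?_
  rw [Finset.sum_comm]
  refine Finset.sum_congr rfl fun y _ => Finset.sum_congr rfl fun x _ => ?_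
  ring

lemma IsPositiveEigensystem.mul_eq_zero_of_not_pos (h : IsPositiveEigensystem Ω K ev φ) {i : ℕ}
    (hi : ¬ 0 < ev i) : ev i = 0 :=
  le_antisymm (not_lt.1 hi) (h.nonneg i)

lemma sum_eigenvalue_mul_sq_le (hΩ : IsCompact Ω) (hc : ContinuousOn K (Ω ×ˢ Ω))
    (hK : IsPSDKernelOn Ω K) (hev : IsPositiveEigensystem Ω K ev φ) (N : ℕ)
    (L : Rn n →₀ ℝ) (hL : (L.support : Set (Rn n)) ⊆ Ω) :
    ∑ i ∈ Finset.range N, ev i * Finsupp.linearCombination ℝ (φ i) L ^ 2 ≤ kernelForm K L L := by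
  rcases Ω.eq_empty_or_nonempty with rfl | hne
  · have : L = 0 := by
      rw [← Finsupp.support_eq_empty]
      exact_mod_cast subset_empty_iff.1 hL
    subst this
    simp [kernelForm]
  set F := (Finset.range N).filter fun i => 0 < ev i with hF
  set w : ℕ → ℝ := fun i => Finsupp.linearCombination ℝ (φ i) L with hw
  have hFpos : ∀ i ∈ F, 0 < ev i := fun i hi => (Finset.mem_filter.1 hi).2
  have hsum : ∑ i ∈ Finset.range N, ev i * w i ^ 2 = ∑ i ∈ F, ev i * w i ^ 2 := by
    rw [hF, Finset.sum_filter]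
    refine Finset.sum_congr rfl fun i _ => ?_
    split_ifs with h
    · rfl
    · rw [hev.mul_eq_zero_of_not_pos h, zero_mul]
  have hcont : ∀ i ∈ F, ContinuousOn (φ i) Ω := fun i hi => hev.continuousOn i (hFpos i hi)
  have hint2 : ∀ i ∈ F, ∀ j ∈ F, IntegrableOn (fun x => φ i x * φ j x) Ω := fun i hi j hj =>
    ((hcont i hi).mul (hcont j hj)).integrableOn_compact hΩ
  set f : Rn n → ℝ := fun y => -∑ i ∈ F, w i * φ i y with hf
  have hfc : ContinuousOn f Ω :=
    (continuousOn_finsetSum F fun i hi => continuousOn_const.mul (hcont i hi)).neg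
  have hKf : ∀ x ∈ Ω, ∫ y in Ω, K (x, y) * f y = -∑ i ∈ F, w i * (ev i * φ i x) := by
    intro x hx
    have hKx : ContinuousOn (fun y => K (x, y)) Ω :=
      hc.comp (by fun_prop) fun y hy => ⟨hx, hy⟩
    simp only [hf, mul_neg, Finset.mul_sum, integral_neg]
    rw [integral_finsetSum]
    · congr 1
      refine Finset.sum_congr rfl fun i hi => ?_
      rw [← hev.eigen i (hFpos i hi) x hx, integralOp, ← integral_const_mul]
      congr 1
      ext y
      ring
    · intro i hi
      exact (hKx.mul (continuousOn_const.mul (hcont i hi))).integrableOn_compact hΩ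
  have key := kernelForm_add_integral_nonneg hΩ hne hc hK L hL (hfc.integrableOn_compact hΩ)
  have h1 : Finsupp.linearCombination ℝ (fun x => ∫ y in Ω, K (x, y) * f y) L =
      -∑ i ∈ F, ev i * w i ^ 2 := by
    simp only [Finsupp.linearCombination_apply, Finsupp.sum, smul_eq_mul]
    rw [Finset.sum_congr rfl fun x hx => by rw [hKf x (hL hx)]]
    simp only [mul_neg, Finset.sum_neg_distrib, Finset.mul_sum]
    rw [Finset.sum_comm]
    congr 1
    refine Finset.sum_congr rfl fun i _ => ?_
    have hwi : w i = ∑ x ∈ L.support, L x * φ i x := by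
      simp only [hw, Finsupp.linearCombination_apply, Finsupp.sum, smul_eq_mul]
    calc _ = ev i * w i * ∑ x ∈ L.support, L x * φ i x := by
          rw [Finset.mul_sum]
          exact Finset.sum_congr rfl fun x _ => by ring
      _ = _ := by rw [← hwi]; ring
  have h2 : ∫ x in Ω, (∫ y in Ω, K (x, y) * f y) * f x = ∑ i ∈ F, ev i * w i ^ 2 := by
    rw [setIntegral_congr_fun (g := fun x => ∑ i ∈ F, ∑ j ∈ F, (w i * ev i * w j) *
      (φ i x * φ j x)) hΩ.measurableSet]
    · rw [integral_finsetSum _ fun i hi => integrable_finsetSum _ fun j hj =>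
        (hint2 i hi j hj).const_mul _]
      refine Finset.sum_congr rfl fun i hi => ?_
      rw [integral_finsetSum _ fun j hj => (hint2 i hi j hj).const_mul _]
      rw [Finset.sum_eq_single i]
      · rw [integral_const_mul, hev.orthonormal i i (hFpos i hi) (hFpos i hi), if_pos rfl]
        ring
      · intro j hj hji
        rw [integral_const_mul, hev.orthonormal i j (hFpos i hi) (hFpos j hj),
          if_neg (Ne.symm hji), mul_zero]
      · exact fun h => absurd hi h
    · intro x hx
      beta_reduce
      rw [hKf x hx]
      simp only [hf, neg_mul_neg, Finset.sum_mul_sum]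
      refine Finset.sum_congr rfl fun i _ => Finset.sum_congr rfl fun j _ => ?_
      ring
  rw [h1, h2] at key
  change ∑ i ∈ Finset.range N, ev i * w i ^ 2 ≤ _
  linarith

theorem isPSDKernelOn_mercerResidual (hΩ : IsCompact Ω) (hc : ContinuousOn K (Ω ×ˢ Ω))
    (hK : IsPSDKernelOn Ω K) (hev : IsPositiveEigensystem Ω K ev φ) (N : ℕ) :
    IsPSDKernelOn Ω (mercerResidual K ev φ N) where
  symm x hx y hy := by
    simp only [mercerResidual, hK.symm x hx y hy]
    congr 1
    exact Finset.sum_congr rfl fun i _ => by ring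
  nonneg L hL := by
    rw [kernelForm_mercerResidual]
    have := sum_eigenvalue_mul_sq_le hΩ hc hK hev N L hL
    simp only [pow_two, ← mul_assoc] at this
    linarith

lemma kernelForm_mercerResidual_le (hev : IsPositiveEigensystem Ω K ev φ) (N : ℕ)
    (L : Rn n →₀ ℝ) : kernelForm (mercerResidual K ev φ N) L L ≤ kernelForm K L L := by
  rw [kernelForm_mercerResidual]
  have : 0 ≤ ∑ i ∈ Finset.range N, ev i * Finsupp.linearCombination ℝ (φ i) L *
        Finsupp.linearCombination ℝ (φ i) L :=
    Finset.sum_nonneg fun i _ => by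
      rw [mul_assoc]
      exact mul_nonneg (hev.nonneg i) (mul_self_nonneg _)
  linarith

lemma continuousOn_mercerResidual (hc : ContinuousOn K (Ω ×ˢ Ω))
    (hev : IsPositiveEigensystem Ω K ev φ) (N : ℕ) :
    ContinuousOn (mercerResidual K ev φ N) (Ω ×ˢ Ω) := by
  refine hc.sub (continuousOn_finsetSum _ fun i _ => ?_)
  by_cases hi : 0 < ev i
  · have h1 : ContinuousOn (fun z : Rn n × Rn n => φ i z.1) (Ω ×ˢ Ω) :=
      (hev.continuousOn i hi).comp continuousOn_fst fun z hz => hz.1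
    have h2 : ContinuousOn (fun z : Rn n × Rn n => φ i z.2) (Ω ×ˢ Ω) :=
      (hev.continuousOn i hi).comp continuousOn_snd fun z hz => hz.2
    exact (continuousOn_const.mul h1).mul h2
  · simp only [hev.mul_eq_zero_of_not_pos hi, zero_mul]
    exact continuousOn_const

lemma mercerError_eq (Ω : Set (Rn n)) (K : Rn n × Rn n → ℝ) (ev : ℕ → ℝ) (φ : ℕ → Rn n → ℝ)
    (N : ℕ) : mercerError Ω K ev φ N =
      ⨆ x ∈ Ω, ⨆ y ∈ Ω, ‖mercerResidual K ev φ N (x, y)‖ₑ := rfl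

end Residual

section Hilbert

variable {H : Type*} [NormedAddCommGroup H] [InnerProductSpace ℝ H]

/-- A compact symmetric operator vanishes on an invariant closed subspace without eigenvectors to
nonzero eigenvalues. -/
theorem IsCompactOperator.eq_zero_of_no_eigenvector {T : H →L[ℝ] H} (hT : IsCompactOperator T)
    (hs : T.IsSymmetric) (W : Submodule ℝ H) [CompleteSpace W] (hinv : ∀ f ∈ W, T f ∈ W)
    (hno : ∀ c : ℝ, c ≠ 0 → ∀ f ∈ W, T f = c • f → f = 0) {f : H} (hf : f ∈ W) : T f = 0 := by
  let S : W →L[ℝ] W := T.restrict hinv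
  have hSc : IsCompactOperator S := IsCompactOperator.restrict' hT hinv
  have hSs : S.IsSymmetric := hs.restrict_invariant hinv
  have h0 : S = 0 := by
    refine (ContinuousLinearMap.eq_zero_of_forall_hasEigenvalue_eq_zero hSc hSs).1 fun c hc => ?_
    by_contra hc0
    obtain ⟨v, hv⟩ := hc.exists_hasEigenvector
    have h1 : T v = c • (v : H) := congrArg Subtype.val hv.apply_eq_smul
    exact hv.2 (Subtype.ext (hno c hc0 v v.2 h1))
  exact congrArg Subtype.val (DFunLike.congr_fun h0 ⟨f, hf⟩)

/-- Parseval's identity for a vector in the closed span of an orthonormal family. -/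
theorem Orthonormal.hasSum_inner_sq [CompleteSpace H] {ι : Type*} {e : ι → H} (he : Orthonormal ℝ e) {r : H}
    (hr : r ∈ ((Submodule.span ℝ (range e))ᗮ)ᗮ) :
    HasSum (fun i => inner ℝ (e i) r ^ 2) (‖r‖ ^ 2) := by
  obtain ⟨w, b, hw, hb⟩ := he.toSubtypeRange.exists_hilbertBasis_extension
  have hbv : ∀ v : w, b v = v := fun v => congrFun hb v
  have hsum := b.hasSum_inner_mul_inner r r
  rw [real_inner_self_eq_norm_sq] at hsum
  let g : ι → w := fun i => ⟨e i, hw (mem_range_self i)⟩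
  have hg : Function.Injective g := fun i j hij =>
    he.linearIndependent.injective (congrArg Subtype.val hij)
  have hzero : ∀ v ∉ range g, inner ℝ r (b v) * inner ℝ (b v) r = 0 := by
    intro v hv
    have hperp : (b v : H) ∈ (Submodule.span ℝ (range e))ᗮ := by
      rw [Submodule.mem_orthogonal]
      intro u hu
      induction hu using Submodule.span_induction with
      | mem x hx =>
        obtain ⟨i, rfl⟩ := hx
        have h2 : b (g i) = e i := hbv (g i)
        rw [← h2]
        exact b.orthonormal.2 fun h => hv ⟨i, h⟩
      | zero => simp
      | add x y _ _ hx hy => rw [inner_add_left, hx, hy, add_zero]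
      | smul a x _ hx => rw [inner_smul_left, hx, mul_zero]
    rw [(Submodule.mem_orthogonal _ _).1 hr _ hperp, mul_zero]
  have := (hg.hasSum_iff hzero).2 hsum
  convert this using 2 with i
  simp only [Function.comp, hbv, g]
  rw [real_inner_comm, pow_two]

end Hilbert

section Pairing

variable {X H : Type*} [MeasurableSpace X] (μ : Measure X) [NormedAddCommGroup H]
  [InnerProductSpace ℝ H]

/-- The operator `f ↦ (x ↦ ⟪f, g x⟫)` defined by an `L²` function `g` with values in `H`. -/
noncomputable def pairingOp : Lp H 2 μ →L[ℝ] H →L[ℝ] Lp ℝ 2 μ :=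
  LinearMap.mkContinuous₂
    (LinearMap.mk₂ ℝ (fun (g : Lp H 2 μ) (f : H) => (innerSL ℝ f).compLpL 2 μ g)
      (fun _ _ _ => map_add _ _ _) (fun _ _ _ => map_smul _ _ _)
      (fun g f f' => by
        simp only [map_add]
        exact ContinuousLinearMap.add_compLp _ _ g)
      (fun c g f => by
        simp only [map_smul]
        exact ContinuousLinearMap.smul_compLp c _ g)) 1
    (fun g f => by
      rw [one_mul, mul_comm, LinearMap.mk₂_apply]
      refine (ContinuousLinearMap.norm_compLp_le _ g).trans_eq ?_
      rw [innerSL_apply_norm])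

lemma coeFn_pairingOp (g : Lp H 2 μ) (f : H) :
    pairingOp μ g f =ᵐ[μ] fun x => inner ℝ f (g x) :=
  (innerSL ℝ f).coeFn_compLp g

theorem isCompactOperator_pairingOp (g : Lp H 2 μ) : IsCompactOperator (pairingOp μ g) := by
  refine Lp.induction (by norm_num) (fun g => IsCompactOperator (pairingOp μ g)) ?_ ?_ ?_ g
  · intro c s hs hμs
    rw [Lp.simpleFunc.coe_indicatorConst]
    have h : pairingOp μ (indicatorConstLp 2 hs hμs.ne c) =
        (ContinuousLinearMap.toSpanSingleton ℝ (indicatorConstLp 2 hs hμs.ne (1 : ℝ))).comp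
          (innerSL ℝ c) := by
      ext1 f
      refine Lp.ext ?_
      have h1 := coeFn_pairingOp μ (indicatorConstLp 2 hs hμs.ne c) f
      have h2 := indicatorConstLp_coeFn (p := 2) (hs := hs) (hμs := hμs.ne) (c := c)
      have h3 := indicatorConstLp_coeFn (p := 2) (hs := hs) (hμs := hμs.ne) (c := (1 : ℝ))
      have h4 := Lp.coeFn_smul (inner ℝ c f) (indicatorConstLp 2 hs hμs.ne (1 : ℝ))
      simp only [ContinuousLinearMap.comp_apply, ContinuousLinearMap.toSpanSingleton_apply,
        innerSL_apply_apply]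
      filter_upwards [h1, h2, h3, h4] with x h1 h2 h3 h4
      rw [h1, h2, h4, Pi.smul_apply, h3]
      by_cases hx : x ∈ s
      · simp [hx, real_inner_comm]
      · simp [hx]
    rw [h]
    exact (isCompactOperator_of_locallyCompactSpace_dom (innerSL ℝ c)).clm_comp
      (ContinuousLinearMap.toSpanSingleton ℝ (indicatorConstLp 2 hs hμs.ne (1 : ℝ)))
  · intro f g hf hg _ h1 h2
    simp only [map_add]
    exact h1.add h2
  · exact isClosed_setOfPred_isCompactOperator.preimage (pairingOp μ).continuous

end Pairing

section L2

lemma memLp_restrict_of_continuousOn {X F : Type*} [TopologicalSpace X] [MeasurableSpace X]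
    [BorelSpace X] [T2Space X] [SecondCountableTopology X] [NormedAddCommGroup F] {μ : Measure X}
    [IsFiniteMeasureOnCompacts μ] {S : Set X} (hS : IsCompact S) {f : X → F}
    (hf : ContinuousOn f S) (p : ℝ≥0∞) : MemLp f p (μ.restrict S) := by
  obtain ⟨C, hC⟩ := hS.exists_bound_of_continuousOn hf
  have : IsFiniteMeasure (μ.restrict S) := ⟨by simpa using hS.measure_lt_top⟩
  refine MemLp.of_bound (hf.aestronglyMeasurable hS.measurableSet) C ?_
  filter_upwards [ae_restrict_mem hS.measurableSet] with x hx using hC x hx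

variable {n : ℕ} {Ω : Set (Rn n)} {K : Rn n × Rn n → ℝ}

lemma continuousOn_section (hc : ContinuousOn K (Ω ×ˢ Ω)) {x : Rn n} (hx : x ∈ Ω) :
    ContinuousOn (fun y => K (x, y)) Ω :=
  hc.comp (by fun_prop) fun _ hy => ⟨hx, hy⟩

open Classical in
/-- The section `K(x, ·)` as an element of `L²(Ω)`, for `x ∈ Ω`. -/
noncomputable def kernelSection (hΩ : IsCompact Ω) (hc : ContinuousOn K (Ω ×ˢ Ω)) (x : Rn n) :
    Lp ℝ 2 (volume.restrict Ω) :=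
  if hx : x ∈ Ω then (memLp_restrict_of_continuousOn hΩ (continuousOn_section hc hx) 2).toLp _
  else 0

lemma coeFn_kernelSection (hΩ : IsCompact Ω) (hc : ContinuousOn K (Ω ×ˢ Ω)) {x : Rn n}
    (hx : x ∈ Ω) : kernelSection hΩ hc x =ᵐ[volume.restrict Ω] fun y => K (x, y) := by
  rw [kernelSection, dif_pos hx]
  exact MemLp.coeFn_toLp _

lemma continuousOn_kernelSection (hΩ : IsCompact Ω) (hc : ContinuousOn K (Ω ×ˢ Ω)) :
    ContinuousOn (kernelSection hΩ hc) Ω := by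
  have : IsFiniteMeasure (volume.restrict Ω) := ⟨by simpa using hΩ.measure_lt_top⟩
  rw [Metric.continuousOn_iff]
  intro x hx ε hε
  set A := (volume.restrict Ω).real univ ^ (ENNReal.toReal 2)⁻¹ with hA
  have hA0 : 0 ≤ A := by positivity
  obtain ⟨δ, hδ, h⟩ := Metric.uniformContinuousOn_iff.1
    ((hΩ.prod hΩ).uniformContinuousOn_of_continuous hc) (ε / (A + 1)) (by positivity)
  refine ⟨δ, hδ, fun y hy hxy => ?_⟩
  rw [dist_eq_norm]
  have hb : ‖kernelSection hΩ hc y - kernelSection hΩ hc x‖ ≤ A * (ε / (A + 1)) := by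
    refine Lp.norm_le_of_ae_bound (by positivity) ?_
    filter_upwards [coeFn_kernelSection hΩ hc hx, coeFn_kernelSection hΩ hc hy,
      Lp.coeFn_sub (kernelSection hΩ hc y) (kernelSection hΩ hc x),
      ae_restrict_mem hΩ.measurableSet] with z h1 h2 h3 hz
    rw [h3, Pi.sub_apply, h1, h2, ← dist_eq_norm]
    refine (h (y, z) ⟨hy, hz⟩ (x, z) ⟨hx, hz⟩ ?_).le
    rw [Prod.dist_eq, dist_self]
    exact max_lt hxy hδ
  refine hb.trans_lt ?_
  rw [mul_div_assoc', div_lt_iff₀ (by positivity)]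
  nlinarith

lemma memLp_kernelSection (hΩ : IsCompact Ω) (hc : ContinuousOn K (Ω ×ˢ Ω)) :
    MemLp (kernelSection hΩ hc) 2 (volume.restrict Ω) :=
  memLp_restrict_of_continuousOn hΩ (continuousOn_kernelSection hΩ hc) 2

lemma inner_kernelSection (hΩ : IsCompact Ω) (hc : ContinuousOn K (Ω ×ˢ Ω)) {x : Rn n}
    (hx : x ∈ Ω) (f : Lp ℝ 2 (volume.restrict Ω)) :
    inner ℝ f (kernelSection hΩ hc x) = integralOp Ω K f x := by
  rw [L2.inner_def, integralOp]
  refine integral_congr_ae ?_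
  filter_upwards [coeFn_kernelSection hΩ hc hx] with y hy
  rw [hy]
  simp

/-- The integral operator with kernel `K` on `L²(Ω)`. -/
noncomputable def integralOpL2 (hΩ : IsCompact Ω) (hc : ContinuousOn K (Ω ×ˢ Ω)) :
    Lp ℝ 2 (volume.restrict Ω) →L[ℝ] Lp ℝ 2 (volume.restrict Ω) :=
  pairingOp (volume.restrict Ω) (memLp_kernelSection hΩ hc).toLp

lemma coeFn_integralOpL2 (hΩ : IsCompact Ω) (hc : ContinuousOn K (Ω ×ˢ Ω))
    (f : Lp ℝ 2 (volume.restrict Ω)) :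
    integralOpL2 hΩ hc f =ᵐ[volume.restrict Ω] integralOp Ω K f := by
  filter_upwards [coeFn_pairingOp (volume.restrict Ω) (memLp_kernelSection hΩ hc).toLp f,
    (memLp_kernelSection hΩ hc).coeFn_toLp, ae_restrict_mem hΩ.measurableSet] with x h1 h2 hx
  rw [← inner_kernelSection hΩ hc hx f, ← h2]
  exact h1

lemma inner_integralOpL2 (hΩ : IsCompact Ω) (hc : ContinuousOn K (Ω ×ˢ Ω))
    (f g : Lp ℝ 2 (volume.restrict Ω)) :
    inner ℝ (integralOpL2 hΩ hc f) g = ∫ x in Ω, (∫ y in Ω, K (x, y) * f y) * g x := by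
  rw [L2.inner_def]
  refine integral_congr_ae ?_
  filter_upwards [coeFn_integralOpL2 hΩ hc f] with x hx
  rw [hx, integralOp]
  simp [mul_comm]

lemma integrable_coeFn_L2 (hΩ : IsCompact Ω) (f : Lp ℝ 2 (volume.restrict Ω)) :
    IntegrableOn f Ω := by
  have : IsFiniteMeasure (volume.restrict Ω) := ⟨by simpa using hΩ.measure_lt_top⟩
  exact (Lp.memLp f).integrable (by norm_num)

lemma isSymmetric_integralOpL2 (hΩ : IsCompact Ω) (hc : ContinuousOn K (Ω ×ˢ Ω))
    (hK : IsPSDKernelOn Ω K) : (integralOpL2 hΩ hc).IsSymmetric := by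
  intro f g
  have : IsFiniteMeasure (volume.restrict Ω) := ⟨by simpa using hΩ.measure_lt_top⟩
  change inner ℝ (integralOpL2 hΩ hc f) g = inner ℝ f (integralOpL2 hΩ hc g)
  rw [real_inner_comm (integralOpL2 hΩ hc g) f, inner_integralOpL2, inner_integralOpL2]
  obtain ⟨C, -, hC⟩ := exists_abs_le_of_continuousOn hΩ hc
  have hint : Integrable (Function.uncurry fun x y => K (x, y) * (f y * g x))
      ((volume.restrict Ω).prod (volume.restrict Ω)) := by
    have h1 : Integrable (fun z : Rn n × Rn n => f z.2 * g z.1)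
        ((volume.restrict Ω).prod (volume.restrict Ω)) := by
      simpa only [mul_comm] using
        (integrable_coeFn_L2 hΩ g).mul_prod (integrable_coeFn_L2 hΩ f)
    refine h1.bdd_mul (c := C) ?_ ?_
    · rw [Measure.prod_restrict]
      exact hc.aestronglyMeasurable (hΩ.prod hΩ).measurableSet
    · rw [Measure.prod_restrict]
      filter_upwards [ae_restrict_mem (hΩ.prod hΩ).measurableSet] with z hz
        using hC z.1 hz.1 z.2 hz.2
  simp only [← integral_mul_const, mul_assoc]
  rw [integral_integral_swap hint]
  refine setIntegral_congr_fun hΩ.measurableSet fun x hx =>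
    setIntegral_congr_fun hΩ.measurableSet fun y hy => ?_
  simp only [hK.symm x hx y hy]
  ring

variable {ev : ℕ → ℝ} {φ : ℕ → Rn n → ℝ}

/-- The eigenfunctions to positive eigenvalues as elements of `L²(Ω)`. -/
noncomputable def eigenvectorL2 (hΩ : IsCompact Ω) (hev : IsPositiveEigensystem Ω K ev φ)
    (i : {i // 0 < ev i}) : Lp ℝ 2 (volume.restrict Ω) :=
  (memLp_restrict_of_continuousOn hΩ (hev.continuousOn i i.2) 2).toLp

lemma coeFn_eigenvectorL2 (hΩ : IsCompact Ω) (hev : IsPositiveEigensystem Ω K ev φ)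
    (i : {i // 0 < ev i}) : eigenvectorL2 hΩ hev i =ᵐ[volume.restrict Ω] φ i :=
  MemLp.coeFn_toLp _

lemma inner_eigenvectorL2 (hΩ : IsCompact Ω) (hev : IsPositiveEigensystem Ω K ev φ)
    (i : {i // 0 < ev i}) (f : Lp ℝ 2 (volume.restrict Ω)) :
    inner ℝ (eigenvectorL2 hΩ hev i) f = ∫ x in Ω, f x * φ i x := by
  rw [L2.inner_def]
  refine integral_congr_ae ?_
  filter_upwards [coeFn_eigenvectorL2 hΩ hev i] with x hx
  rw [hx]
  simp

lemma orthonormal_eigenvectorL2 (hΩ : IsCompact Ω) (hev : IsPositiveEigensystem Ω K ev φ) :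
    Orthonormal ℝ (eigenvectorL2 hΩ hev) := by
  classical
  rw [orthonormal_iff_ite]
  intro i j
  rw [inner_eigenvectorL2, integral_congr_ae (g := fun x => φ j x * φ i x)]
  · rw [hev.orthonormal j i j.2 i.2]
    simp only [Subtype.ext_iff, eq_comm]
  · filter_upwards [coeFn_eigenvectorL2 hΩ hev j] with x hx
    rw [hx]

lemma integralOpL2_eigenvectorL2 (hΩ : IsCompact Ω) (hc : ContinuousOn K (Ω ×ˢ Ω))
    (hev : IsPositiveEigensystem Ω K ev φ) (i : {i // 0 < ev i}) :
    integralOpL2 hΩ hc (eigenvectorL2 hΩ hev i) = ev i • eigenvectorL2 hΩ hev i := by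
  refine Lp.ext ?_
  filter_upwards [coeFn_integralOpL2 hΩ hc (eigenvectorL2 hΩ hev i),
    Lp.coeFn_smul (ev i) (eigenvectorL2 hΩ hev i), coeFn_eigenvectorL2 hΩ hev i,
    ae_restrict_mem hΩ.measurableSet] with x h1 h2 h3 hx
  rw [h1, h2, Pi.smul_apply, h3, smul_eq_mul, ← hev.eigen i i.2 x hx]
  refine integral_congr_ae ?_
  filter_upwards [coeFn_eigenvectorL2 hΩ hev i] with y hy
  rw [hy]

/-- The integral operator vanishes on the orthogonal complement of the listed eigenfunctions. -/
theorem integralOpL2_eq_zero (hΩ : IsCompact Ω) (hne : Ω.Nonempty)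
    (hc : ContinuousOn K (Ω ×ˢ Ω)) (hK : IsPSDKernelOn Ω K)
    (hev : IsPositiveEigensystem Ω K ev φ) {f : Lp ℝ 2 (volume.restrict Ω)}
    (hf : f ∈ (Submodule.span ℝ (range (eigenvectorL2 hΩ hev)))ᗮ) :
    integralOpL2 hΩ hc f = 0 := by
  have hmem : ∀ g, g ∈ (Submodule.span ℝ (range (eigenvectorL2 hΩ hev)))ᗮ ↔
      ∀ i, inner ℝ (eigenvectorL2 hΩ hev i) g = 0 := by
    intro g
    rw [Submodule.mem_orthogonal]
    refine ⟨fun h i => h _ (Submodule.subset_span (mem_range_self i)), fun h u hu => ?_⟩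
    induction hu using Submodule.span_induction with
    | mem x hx => obtain ⟨i, rfl⟩ := hx; exact h i
    | zero => simp
    | add x y _ _ hx hy => rw [inner_add_left, hx, hy, add_zero]
    | smul a x _ hx => rw [inner_smul_left, hx, mul_zero]
  have hsym := isSymmetric_integralOpL2 hΩ hc hK
  refine IsCompactOperator.eq_zero_of_no_eigenvector (isCompactOperator_pairingOp _ _) hsym
    (Submodule.span ℝ (range (eigenvectorL2 hΩ hev)))ᗮ ?_ ?_ hf
  · intro g hg
    rw [hmem] at hg ⊢
    intro i
    have h1 := hsym (eigenvectorL2 hΩ hev i) g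
    change inner ℝ (integralOpL2 hΩ hc (eigenvectorL2 hΩ hev i)) g =
      inner ℝ (eigenvectorL2 hΩ hev i) (integralOpL2 hΩ hc g) at h1
    change inner ℝ (eigenvectorL2 hΩ hev i) (integralOpL2 hΩ hc g) = 0
    rw [← h1, integralOpL2_eigenvectorL2, inner_smul_left, hg i, mul_zero]
  · intro c hc0 g hg hTg
    change integralOpL2 hΩ hc g = c • g at hTg
    have hpos : 0 ≤ c * ‖g‖ ^ 2 := by
      have h1 := kernelForm_add_integral_nonneg hΩ hne hc hK 0 (by simp)
        (integrable_coeFn_L2 hΩ g)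
      rw [← inner_integralOpL2 hΩ hc g g, hTg, inner_smul_left, real_inner_self_eq_norm_sq] at h1
      simpa [kernelForm] using h1
    rcases lt_or_gt_of_ne hc0 with hneg | hcpos
    · have : ‖g‖ ^ 2 = 0 := le_antisymm (by nlinarith) (by positivity)
      simpa using this
    · rw [Lp.eq_zero_iff_ae_eq_zero]
      refine hev.complete c g hcpos (Lp.memLp g) ?_ fun i hi => ?_
      · filter_upwards [coeFn_integralOpL2 hΩ hc g, Lp.coeFn_smul c g] with x h1 h2
        rw [← h1, hTg, h2, Pi.smul_apply, smul_eq_mul]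
      · rw [← inner_eigenvectorL2 hΩ hev ⟨i, hi⟩]
        exact (hmem g).1 hg ⟨i, hi⟩

theorem kernelSection_mem_orthogonal (hΩ : IsCompact Ω) 
    (hc : ContinuousOn K (Ω ×ˢ Ω)) (hK : IsPSDKernelOn Ω K)
    (hev : IsPositiveEigensystem Ω K ev φ) {x : Rn n} (hx : x ∈ interior Ω) :
    kernelSection hΩ hc x ∈ ((Submodule.span ℝ (range (eigenvectorL2 hΩ hev)))ᗮ)ᗮ := by
  rw [Submodule.mem_orthogonal]
  intro f hf
  have h0 := integralOpL2_eq_zero hΩ ⟨x, interior_subset hx⟩ hc hK hev hf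
  have h1 : (fun x => inner ℝ f (kernelSection hΩ hc x)) =ᵐ[volume.restrict (interior Ω)]
      fun _ => (0 : ℝ) := by
    refine ae_restrict_of_ae_restrict_of_subset interior_subset ?_
    filter_upwards [coeFn_integralOpL2 hΩ hc f, ae_restrict_mem hΩ.measurableSet,
      (Lp.eq_zero_iff_ae_eq_zero).1 h0] with y h1 hy h2
    rw [inner_kernelSection hΩ hc hy, ← h1, h2]
    rfl
  exact Measure.eqOn_open_of_ae_eq h1 isOpen_interior
    (continuousOn_const.inner ((continuousOn_kernelSection hΩ hc).mono interior_subset))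
    continuousOn_const hx

end L2

section ResidualNorm

variable {n : ℕ} {Ω : Set (Rn n)} {K : Rn n × Rn n → ℝ} {ev : ℕ → ℝ} {φ : ℕ → Rn n → ℝ}

lemma IsPositiveEigensystem.continuousOn_mul (hev : IsPositiveEigensystem Ω K ev φ) (i : ℕ) :
    ContinuousOn (fun x => ev i * φ i x) Ω := by
  by_cases hi : 0 < ev i
  · exact continuousOn_const.mul (hev.continuousOn i hi)
  · simp only [hev.mul_eq_zero_of_not_pos hi, zero_mul]
    exact continuousOn_const

lemma lintegral_enorm_sq_eq_ofReal_norm_sq {X : Type*} [MeasurableSpace X] {μ : Measure X}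
    (f : Lp ℝ 2 μ) : ∫⁻ x, ‖f x‖ₑ ^ 2 ∂μ = ENNReal.ofReal (‖f‖ ^ 2) := by
  have h := eLpNorm_eq_lintegral_rpow_enorm_toReal (p := 2) (μ := μ) (f := f) (by norm_num)
    (by norm_num)
  rw [ENNReal.ofReal_pow (norm_nonneg _), Lp.norm_def, ENNReal.ofReal_toReal (Lp.eLpNorm_ne_top f),
    h, ← ENNReal.rpow_natCast, ← ENNReal.rpow_mul]
  simp

theorem lintegral_mercerResidual_section (hΩ : IsCompact Ω) (hc : ContinuousOn K (Ω ×ˢ Ω))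
    (hK : IsPSDKernelOn Ω K) (hev : IsPositiveEigensystem Ω K ev φ) (N : ℕ) {x : Rn n}
    (hx : x ∈ interior Ω) : ∫⁻ y in Ω, ‖mercerResidual K ev φ N (x, y)‖ₑ ^ 2 =
      ∑' i, ENNReal.ofReal ((ev (N + i) * φ (N + i) x) ^ 2) := by
  classical
  have hxΩ := interior_subset hx
  set e := eigenvectorL2 hΩ hev with he
  have hon : Orthonormal ℝ e := orthonormal_eigenvectorL2 hΩ hev
  set F : Finset {i // 0 < ev i} := (Finset.range N).subtype fun i => 0 < ev i with hF
  set r : Lp ℝ 2 (volume.restrict Ω) := kernelSection hΩ hc x - ∑ i ∈ F, (ev i * φ i x) • e i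
    with hr
  have hrV : r ∈ ((Submodule.span ℝ (range e))ᗮ)ᗮ := by
    refine Submodule.sub_mem _ (kernelSection_mem_orthogonal hΩ hc hK hev hx) ?_
    refine Submodule.sum_mem _ fun i _ => Submodule.smul_mem _ _ ?_
    exact Submodule.le_orthogonal_orthogonal _ (Submodule.subset_span (mem_range_self i))
  have hrae : r =ᵐ[volume.restrict Ω] fun y => mercerResidual K ev φ N (x, y) := by
    have h1 : ∀ᵐ y ∂volume.restrict Ω, ∀ i ∈ F, ((ev i * φ i x) • e i : Lp ℝ 2 _) y =
        ev i * φ i x * φ i y := by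
      rw [Filter.eventually_all_finset]
      intro i _
      filter_upwards [Lp.coeFn_smul (ev i * φ i x) (e i), coeFn_eigenvectorL2 hΩ hev i]
        with y h1 h2
      rw [h1, Pi.smul_apply, he, h2, smul_eq_mul]
    filter_upwards [h1, coeFn_kernelSection hΩ hc hxΩ, Lp.coeFn_sub (kernelSection hΩ hc x)
      (∑ i ∈ F, (ev i * φ i x) • e i), Lp.coeFn_finsetSum F fun i => (ev i * φ i x) • e i]
      with y h1 h2 h3 h4
    rw [h3, Pi.sub_apply, h2, h4, mercerResidual, Finset.sum_apply, Finset.sum_congr rfl h1]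
    congr 1
    rw [hF, Finset.sum_subtype_eq_sum_filter (s := Finset.range N) (p := fun i => 0 < ev i)
      (fun i => ev i * φ i x * φ i y), Finset.sum_filter]
    refine Finset.sum_congr rfl fun i _ => ?_
    split_ifs with h
    · rfl
    · rw [hev.mul_eq_zero_of_not_pos h, zero_mul, zero_mul]
  have hcoef : ∀ i, inner ℝ (e i) r = if (i : ℕ) < N then 0 else ev i * φ i x := by
    intro i
    have h1 : inner ℝ (e i) (kernelSection hΩ hc x) = ev i * φ i x := by
      rw [inner_kernelSection hΩ hc hxΩ, ← hev.eigen i i.2 x hxΩ]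
      refine integral_congr_ae ?_
      filter_upwards [coeFn_eigenvectorL2 hΩ hev i] with y hy
      rw [he, hy]
    have h2 := orthonormal_iff_ite.1 hon
    rw [hr, inner_sub_right, h1, inner_sum]
    simp only [inner_smul_right, h2, mul_ite, mul_one, mul_zero, Finset.sum_ite_eq]
    by_cases hi : (i : ℕ) < N
    · simp [hF, hi]
    · simp [hF, hi]
  rw [lintegral_congr_ae (g := fun y => ‖r y‖ₑ ^ 2) (by
    filter_upwards [hrae] with y hy
    rw [hy]), lintegral_enorm_sq_eq_ofReal_norm_sq]
  have hsum := hon.hasSum_inner_sq hrV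
  rw [← hsum.tsum_eq, ENNReal.ofReal_tsum_of_nonneg (fun i => sq_nonneg _) hsum.summable]
  simp only [hcoef]
  let a : ℕ → ℝ≥0∞ := fun i => ENNReal.ofReal ((if i < N then 0 else ev i * φ i x) ^ 2)
  change ∑' i : {i // 0 < ev i}, a i = _
  have h3 : ∑' i : {i // 0 < ev i}, a i = ∑' i, a i := by
    refine tsum_subtype_eq_of_support_subset (s := {i | 0 < ev i}) fun i hi => ?_
    by_contra hpos
    refine hi ?_
    simp only [a, hev.mul_eq_zero_of_not_pos hpos, zero_mul, ite_self]
    simp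
  rw [h3, ← ENNReal.summable.sum_add_tsum_nat_add' (k := N) (f := a), Finset.sum_eq_zero, zero_add]
  · refine tsum_congr fun i => ?_
    simp [a, add_comm]
  · intro i hi
    simp [a, Finset.mem_range.1 hi]

theorem lintegral_mercerResidual_sq_le (hΩ : IsCompact Ω) (hbd : volume (frontier Ω) = 0)
    (hc : ContinuousOn K (Ω ×ˢ Ω)) (hK : IsPSDKernelOn Ω K)
    (hev : IsPositiveEigensystem Ω K ev φ) (N : ℕ) :
    ∫⁻ x in Ω, ∫⁻ y in Ω, ‖mercerResidual K ev φ N (x, y)‖ₑ ^ 2 ≤ sqTail ev N := by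
  have hint : ∀ᵐ x ∂volume.restrict Ω, x ∈ interior Ω := by
    have h1 : ∀ᵐ x ∂(volume : Measure (Rn n)), x ∉ frontier Ω := measure_eq_zero_iff_ae_notMem.1 hbd
    filter_upwards [ae_restrict_of_ae h1, ae_restrict_mem hΩ.measurableSet] with x h1 h2
    by_contra h3
    exact h1 ⟨subset_closure h2, h3⟩
  rw [lintegral_congr_ae (g := fun x => ∑' i, ENNReal.ofReal ((ev (N + i) * φ (N + i) x) ^ 2)) (by
    filter_upwards [hint] with x hx
    exact lintegral_mercerResidual_section hΩ hc hK hev N hx)]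
  rw [lintegral_tsum]
  · refine ENNReal.tsum_le_tsum fun i => ?_
    by_cases hi : 0 < ev (N + i)
    · have hφ := hev.continuousOn _ hi
      rw [← ofReal_integral_eq_lintegral_ofReal]
      · simp only [mul_pow, integral_const_mul]
        have := hev.orthonormal _ _ hi hi
        simp only [if_true, ← pow_two] at this
        rw [this, mul_one]
      · exact ((hev.continuousOn_mul _).pow 2).integrableOn_compact hΩ
      · exact Filter.Eventually.of_forall fun x => sq_nonneg _
    · simp [hev.mul_eq_zero_of_not_pos hi]
  · intro i
    exact (((hev.continuousOn_mul _).pow 2).aemeasurable hΩ.measurableSet).ennreal_ofReal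

lemma sqTail_le_sqTail_zero (ev : ℕ → ℝ) (N : ℕ) : sqTail ev N ≤ sqTail ev 0 := by
  simp only [sqTail, zero_add]
  exact ENNReal.tsum_comp_le_tsum_of_injective (fun i j h => Nat.add_left_cancel h)
    fun i => ENNReal.ofReal (ev i ^ 2)

theorem sqTail_ne_top (hΩ : IsCompact Ω) (hc : ContinuousOn K (Ω ×ˢ Ω))
    (hK : IsPSDKernelOn Ω K) (hev : IsPositiveEigensystem Ω K ev φ) (N : ℕ) :
    sqTail ev N ≠ ⊤ := by
  obtain ⟨C, hC0, hC⟩ := exists_abs_le_of_continuousOn hΩ hc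
  have : IsFiniteMeasure (volume.restrict Ω) := ⟨by simpa using hΩ.measure_lt_top⟩
  set A := C * (volume.restrict Ω).real univ with hA
  have hA0 : 0 ≤ A := by positivity
  have hsum : ∀ M, ∑ i ∈ Finset.range M, ev i ≤ A := by
    intro M
    have h1 : ∀ x ∈ Ω, ∑ i ∈ Finset.range M, ev i * φ i x * φ i x ≤ C := by
      intro x hx
      have := sum_eigenvalue_mul_sq_le hΩ hc hK hev M _ (support_single_subset hx 1)
      simp only [Finsupp.linearCombination_single, kernelForm_single, one_smul, one_mul,
        pow_two, ← mul_assoc] at this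
      exact this.trans ((le_abs_self _).trans (hC x hx x hx))
    have hcont : ∀ i, ContinuousOn (fun x => ev i * φ i x * φ i x) Ω := by
      intro i
      by_cases hi : 0 < ev i
      · exact (hev.continuousOn_mul i).mul (hev.continuousOn i hi)
      · simp only [hev.mul_eq_zero_of_not_pos hi, zero_mul]
        exact continuousOn_const
    have h2 : ∫ x in Ω, ∑ i ∈ Finset.range M, ev i * φ i x * φ i x = 
        ∑ i ∈ Finset.range M, ev i := by
      rw [integral_finsetSum _ fun i _ => (hcont i).integrableOn_compact hΩ]
      refine Finset.sum_congr rfl fun i _ => ?_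
      by_cases hi : 0 < ev i
      · simp only [mul_assoc, integral_const_mul]
        rw [hev.orthonormal i i hi hi, if_pos rfl, mul_one]
      · simp [hev.mul_eq_zero_of_not_pos hi]
    rw [← h2]
    calc _ ≤ ∫ x in Ω, C := setIntegral_mono_on
          (integrable_finsetSum _ fun i _ => (hcont i).integrableOn_compact hΩ)
          (integrable_const _) hΩ.measurableSet h1
      _ = A := by simp [hA, mul_comm]
  refine ne_top_of_le_ne_top ?_ (sqTail_le_sqTail_zero ev N)
  refine ne_top_of_le_ne_top (b := ENNReal.ofReal (A ^ 2)) (by simp) ?_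
  simp only [sqTail, zero_add]
  refine ENNReal.tsum_le_of_sum_range_le fun M => ?_
  rw [← ENNReal.ofReal_sum_of_nonneg fun i _ => sq_nonneg _]
  refine ENNReal.ofReal_le_ofReal ?_
  calc ∑ i ∈ Finset.range M, ev i ^ 2 ≤ (∑ i ∈ Finset.range M, ev i) ^ 2 :=
        Finset.sum_sq_le_sq_sum_of_nonneg fun i _ => hev.nonneg i
    _ ≤ A ^ 2 := pow_le_pow_left₀ (Finset.sum_nonneg fun i _ => hev.nonneg i) (hsum M) 2

end ResidualNorm

section LipschitzBoundary

variable {n : ℕ} {Ω : Set (Rn n)}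

lemma mem_interior_of_graph_lt {ν x₀ : Rn n} {γ : Rn n → ℝ} {r : ℝ} (hγ : Continuous γ)
    (h : ∀ x ∈ Metric.ball x₀ r, x ∈ Ω ↔ γ (x - inner ℝ ν x • ν) ≤ inner ℝ ν x) {x : Rn n}
    (hx : x ∈ Metric.ball x₀ r) (hlt : γ (x - inner ℝ ν x • ν) < inner ℝ ν x) :
    x ∈ interior Ω := by
  have hopen : IsOpen {x : Rn n | γ (x - inner ℝ ν x • ν) < inner ℝ ν x} :=
    isOpen_lt (by fun_prop) (by fun_prop)
  refine mem_interior.2 ⟨_, ?_, Metric.isOpen_ball.inter hopen, hx, hlt⟩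
  exact fun y hy => (h y hy.1).2 hy.2.le

lemma volume_graph_eq_zero {ν : Rn n} {γ : Rn n → ℝ} (hν : ‖ν‖ = 1) (hγ : Continuous γ) :
    volume {x : Rn n | inner ℝ ν x = γ (x - inner ℝ ν x • ν)} = 0 := by
  have hinner : inner ℝ ν ν = (1 : ℝ) := by rw [real_inner_self_eq_norm_sq, hν, one_pow]
  refine Measure.addHaar_eq_zero_of_disjoint_translates volume
    (fun k : ℕ => (1 / ((k : ℝ) + 1)) • ν) ?_ ?_ ?_
  · refine (Metric.isBounded_closedBall (x := (0 : Rn n)) (r := 1)).subset ?_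
    rintro _ ⟨k, rfl⟩
    simp only [mem_closedBall_zero_iff, norm_smul, hν, mul_one]
    rw [Real.norm_of_nonneg (by positivity), div_le_one (by positivity)]
    linarith [(Nat.cast_nonneg k : (0 : ℝ) ≤ k)]
  · intro k l hkl
    simp only [Function.onFun, singleton_add]
    rw [Set.disjoint_left]
    rintro _ ⟨x, hx, rfl⟩ ⟨y, hy, hxy⟩
    apply hkl
    simp only [mem_ofPred_eq] at hx hy
    have hy' : y = x + (1 / ((k : ℝ) + 1) - 1 / ((l : ℝ) + 1)) • ν := by
      rw [sub_smul]
      simp only at hxy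
      rw [← add_sub_assoc, add_comm x, ← hxy]
      abel
    set t := 1 / ((k : ℝ) + 1) - 1 / ((l : ℝ) + 1) with ht
    have h1 : inner ℝ ν y = inner ℝ ν x + t := by
      rw [hy', inner_add_right, inner_smul_right, hinner, mul_one]
    have h2 : y - inner ℝ ν y • ν = x - inner ℝ ν x • ν := by
      rw [h1, hy', add_smul]
      abel
    rw [h2, h1, ← hx] at hy
    have ht0 : t = 0 := by linarith
    have h3 : 1 / ((k : ℝ) + 1) = 1 / ((l : ℝ) + 1) := sub_eq_zero.1 ht0
    simpa using h3
  · exact (isClosed_eq (by fun_prop) (by fun_prop)).measurableSet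

theorem volume_frontier_eq_zero (hΩ : IsClosed Ω) (hL : HasLipschitzBoundary Ω) :
    volume (frontier Ω) = 0 := by
  refine measure_null_of_locally_null _ fun x₀ hx₀ => ?_
  obtain ⟨ν, L, γ, r, hν, hγ, hr, h⟩ := hL x₀ hx₀
  refine ⟨frontier Ω ∩ Metric.ball x₀ r,
    Filter.inter_mem self_mem_nhdsWithin (mem_nhdsWithin_of_mem_nhds (Metric.ball_mem_nhds _ hr)), ?_⟩
  refine measure_mono_null ?_ (volume_graph_eq_zero hν hγ.continuous)
  rintro x ⟨hx, hxr⟩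
  have hle := (h x hxr).1 (hΩ.frontier_subset hx)
  refine le_antisymm (not_lt.1 fun hlt => ?_) hle
  exact hx.2 (mem_interior_of_graph_lt hγ.continuous h hxr hlt)

theorem subset_closure_interior (hL : HasLipschitzBoundary Ω) : Ω ⊆ closure (interior Ω) := by
  intro x₀ hx
  by_cases hi : x₀ ∈ interior Ω
  · exact subset_closure hi
  have hx₀ : x₀ ∈ frontier Ω := ⟨subset_closure hx, hi⟩
  obtain ⟨ν, L, γ, r, hν, hγ, hr, h⟩ := hL x₀ hx₀
  have hinner : inner ℝ ν ν = (1 : ℝ) := by rw [real_inner_self_eq_norm_sq, hν, one_pow]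
  have hle := (h x₀ (Metric.mem_ball_self hr)).1 hx
  have hlim : Filter.Tendsto (fun t : ℝ => x₀ + t • ν) (nhdsWithin 0 (Ioi 0)) (nhds x₀) := by
    have : Continuous fun t : ℝ => x₀ + t • ν := by fun_prop
    simpa using (this.tendsto 0).mono_left nhdsWithin_le_nhds
  refine mem_closure_of_tendsto hlim ?_
  filter_upwards [hlim (Metric.ball_mem_nhds x₀ hr), self_mem_nhdsWithin] with t ht ht0
  refine mem_interior_of_graph_lt hγ.continuous h ht ?_
  have h1 : inner ℝ ν (x₀ + t • ν) = inner ℝ ν x₀ + t := by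
    rw [inner_add_right, inner_smul_right, hinner, mul_one]
  have h2 : x₀ + t • ν - inner ℝ ν (x₀ + t • ν) • ν = x₀ - inner ℝ ν x₀ • ν := by
    rw [h1, add_smul]
    abel
  rw [h2, h1]
  have : 0 < t := ht0
  linarith

/-- A compact set with Lipschitz boundary has the uniform interior cone property. -/
theorem exists_uniform_cone (hΩ : IsCompact Ω) (hL : HasLipschitzBoundary Ω) (m : ℕ) :
    ∃ r₀ κ : ℝ, 0 < r₀ ∧ 0 < κ ∧ κ ≤ 1 ∧ ∀ y ∈ interior Ω, ∃ ν : Rn n, ‖ν‖ ≤ 1 ∧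
      ∀ ε, 0 < ε → ε ≤ r₀ → ∀ h ∈ Metric.ball (ε • ν) (κ * ε), ∀ s ∈ Icc (0 : ℝ) m,
        y + s • h ∈ interior Ω := by
  have hnorm : ∀ {ε κ : ℝ} {ν h : Rn n}, 0 < ε → κ ≤ 1 → ‖ν‖ ≤ 1 →
      h ∈ Metric.ball (ε • ν) (κ * ε) → ‖h‖ ≤ 2 * ε := by
    intro ε κ ν h hε hκ hν hh
    rw [mem_ball_iff_norm] at hh
    have h1 := norm_add_le (h - ε • ν) (ε • ν)
    rw [sub_add_cancel, norm_smul, Real.norm_of_nonneg hε.le] at h1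
    nlinarith
  suffices H : ∃ r₀ κ : ℝ, 0 < r₀ ∧ 0 < κ ∧ κ ≤ 1 ∧ ∀ y ∈ interior Ω, y ∈ Ω → ∃ ν : Rn n,
      ‖ν‖ ≤ 1 ∧ ∀ ε, 0 < ε → ε ≤ r₀ → ∀ h ∈ Metric.ball (ε • ν) (κ * ε), ∀ s ∈ Icc (0 : ℝ) m,
        y + s • h ∈ interior Ω by
    obtain ⟨r₀, κ, h1, h2, h3, h4⟩ := H
    exact ⟨r₀, κ, h1, h2, h3, fun y hy => h4 y hy (interior_subset hy)⟩
  refine hΩ.induction_on (p := fun S => ∃ r₀ κ : ℝ, 0 < r₀ ∧ 0 < κ ∧ κ ≤ 1 ∧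
    ∀ y ∈ interior Ω, y ∈ S → ∃ ν : Rn n,
      ‖ν‖ ≤ 1 ∧ ∀ ε, 0 < ε → ε ≤ r₀ → ∀ h ∈ Metric.ball (ε • ν) (κ * ε), ∀ s ∈ Icc (0 : ℝ) m,
        y + s • h ∈ interior Ω) ?_ ?_ ?_ ?_
  · exact ⟨1, 1, one_pos, one_pos, le_rfl, fun y _ h => absurd h (notMem_empty y)⟩
  · rintro S T hST ⟨r₀, κ, h1, h2, h3, h4⟩
    exact ⟨r₀, κ, h1, h2, h3, fun y hy hyS => h4 y hy (hST hyS)⟩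
  · rintro S T ⟨r, κ, h1, h2, h3, h4⟩ ⟨r', κ', h1', h2', h3', h4'⟩
    refine ⟨min r r', min κ κ', lt_min h1 h1', lt_min h2 h2', (min_le_left _ _).trans h3, ?_⟩
    rintro y hy (hyS | hyT)
    · obtain ⟨ν, hν, H⟩ := h4 y hy hyS
      refine ⟨ν, hν, fun ε hε hεr h hh => H ε hε (hεr.trans (min_le_left _ _)) h ?_⟩
      exact Metric.ball_subset_ball (by gcongr; exact min_le_left _ _) hh
    · obtain ⟨ν, hν, H⟩ := h4' y hy hyT
      refine ⟨ν, hν, fun ε hε hεr h hh => H ε hε (hεr.trans (min_le_right _ _)) h ?_⟩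
      exact Metric.ball_subset_ball (by gcongr; exact min_le_right _ _) hh
  · intro x₀ hx
    have hstep : ∀ {r ε κ s : ℝ} {ν h y : Rn n}, 0 < r → y ∈ Metric.ball x₀ (r / 2) → 0 < ε →
        ε ≤ r / (4 * (m + 1)) → κ ≤ 1 → ‖ν‖ ≤ 1 → h ∈ Metric.ball (ε • ν) (κ * ε) →
        s ∈ Icc (0 : ℝ) m → y + s • h ∈ Metric.ball x₀ r := by
      intro r ε κ s ν h y hr hy hε hεr hκ hν hh hs
      have h1 := hnorm hε hκ hν hh
      rw [mem_ball_iff_norm] at hy ⊢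
      have h2 : ‖s • h‖ ≤ m * (2 * ε) := by
        rw [norm_smul, Real.norm_of_nonneg hs.1]
        exact mul_le_mul hs.2 h1 (norm_nonneg _) (by positivity)
      have h3 : ε * (4 * (m + 1)) ≤ r := (le_div_iff₀ (by positivity)).1 hεr
      have h4 := norm_add_le (y - x₀) (s • h)
      rw [show y - x₀ + s • h = y + s • h - x₀ by abel] at h4
      nlinarith
    by_cases hi : x₀ ∈ interior Ω
    · obtain ⟨r, hr, hrΩ⟩ := Metric.isOpen_iff.1 isOpen_interior x₀ hi
      refine ⟨Metric.ball x₀ (r / 2), mem_nhdsWithin_of_mem_nhds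
        (Metric.ball_mem_nhds _ (by positivity)), r / (4 * (m + 1)), 1, by positivity, one_pos,
        le_rfl, fun y _ hyr => ⟨0, by simp, fun ε hε hεr h hh s hs => hrΩ ?_⟩⟩
      exact hstep hr hyr hε hεr le_rfl (by simp) hh hs
    · have hx₀ : x₀ ∈ frontier Ω := ⟨subset_closure hx, hi⟩
      obtain ⟨ν, L, γ, r, hν, hγ, hr, H⟩ := hL x₀ hx₀
      have hinner : inner ℝ ν ν = (1 : ℝ) := by rw [real_inner_self_eq_norm_sq, hν, one_pow]
      set κ : ℝ := 1 / (2 * L + 2) with hκ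
      have hL0 : (0 : ℝ) ≤ L := L.2
      have hκ0 : 0 < κ := by positivity
      have hκL : κ * (2 * L + 2) = 1 := by rw [hκ]; field_simp
      have hκ1 : κ ≤ 1 := by nlinarith
      refine ⟨Metric.ball x₀ (r / 2), mem_nhdsWithin_of_mem_nhds
        (Metric.ball_mem_nhds _ (by positivity)), r / (4 * (m + 1)), κ, by positivity, hκ0,
        hκ1, fun y hy hyr => ⟨ν, hν.le, fun ε hε hεr h hh s hs => ?_⟩⟩
      rcases hs.1.eq_or_lt with rfl | hs0
      · simpa using hy
      have hb := hstep hr hyr hε hεr hκ1 hν.le hh hs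
      refine mem_interior_of_graph_lt hγ.continuous H hb ?_
      have hyle := (H y (Metric.ball_subset_ball (by linarith) hyr)).1 (interior_subset hy)
      set w := h - ε • ν with hw
      have hwn : ‖w‖ < κ * ε := mem_ball_iff_norm.1 hh
      have hνw : |inner ℝ ν w| ≤ ‖w‖ := by
        have := abs_real_inner_le_norm ν w
        rwa [hν, one_mul] at this
      have hh' : h = ε • ν + w := by rw [hw]; abel
      have h1 : inner ℝ ν (y + s • h) = inner ℝ ν y + s * (ε + inner ℝ ν w) := by
        rw [hh', inner_add_right, inner_smul_right, inner_add_right, inner_smul_right, hinner,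
          mul_one]
      have h2 : y + s • h - inner ℝ ν (y + s • h) • ν =
          (y - inner ℝ ν y • ν) + s • (w - inner ℝ ν w • ν) := by
        rw [h1, hh']
        module
      have h3 : ‖w - inner ℝ ν w • ν‖ ≤ 2 * ‖w‖ := by
        refine (norm_sub_le _ _).trans ?_
        rw [norm_smul, hν, mul_one, Real.norm_eq_abs]
        linarith
      have h4 := hγ.dist_le_mul ((y - inner ℝ ν y • ν) + s • (w - inner ℝ ν w • ν))
        (y - inner ℝ ν y • ν)
      rw [dist_eq_norm, dist_eq_norm, add_sub_cancel_left, norm_smul,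
        Real.norm_of_nonneg hs0.le, Real.norm_eq_abs] at h4
      have h5 := (abs_le.1 h4).2
      have h6 := (abs_le.1 hνw).1
      rw [h2, h1]
      have h7 : L * (s * ‖w - inner ℝ ν w • ν‖) ≤ s * (L * (2 * ‖w‖)) := by
        rw [mul_left_comm]
        gcongr
      have h8 : s * (L * (2 * ‖w‖)) < s * (ε + inner ℝ ν w) := by
        refine mul_lt_mul_of_pos_left ?_ hs0
        nlinarith
      linarith

end LipschitzBoundary

section ParametricIntegral

variable {n : ℕ}

/-- Integrals `∫ φ(y) G(x, y) dy` over an open set are as smooth in `x` as `G`, when the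
derivatives of `G` are bounded. -/
theorem contDiffOn_integral_smul {U : Set (Rn n)} (hU : IsOpen U) {φ : Rn n → ℝ}
    (hφ : IntegrableOn φ U) (k : ℕ) {V : Type} [NormedAddCommGroup V] [NormedSpace ℝ V]
    {G : Rn n × Rn n → V} (hG : ContDiffOn ℝ k G (U ×ˢ U))
    (hb : ∀ j ≤ k, ∃ C, ∀ z ∈ U ×ˢ U, ‖iteratedFDeriv ℝ j G z‖ ≤ C) :
    ContDiffOn ℝ k (fun x => ∫ y in U, φ y • G (x, y)) U := by
  have hUU : IsOpen (U ×ˢ U) := hU.prod hU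
  have hmem : ∀ᵐ y ∂volume.restrict U, y ∈ U := ae_restrict_mem hU.measurableSet
  have hmeas : ∀ {W : Type} [NormedAddCommGroup W] [NormedSpace ℝ W] (G : Rn n × Rn n → W),
      ContinuousOn G (U ×ˢ U) → ∀ x ∈ U,
      AEStronglyMeasurable (fun y => φ y • G (x, y)) (volume.restrict U) := by
    intro W _ _ G hG x hx
    exact hφ.aestronglyMeasurable.smul ((hG.comp (Continuous.prodMk_right x).continuousOn
      fun y hy => ⟨hx, hy⟩).aestronglyMeasurable hU.measurableSet)
  have hint : ∀ C : ℝ, Integrable (fun y => ‖φ y‖ * C) (volume.restrict U) := fun C =>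
    hφ.norm.mul_const C
  induction k generalizing V with
  | zero =>
    simp only [Nat.cast_zero, contDiffOn_zero] at hG ⊢
    obtain ⟨C, hC⟩ := hb 0 le_rfl
    simp only [norm_iteratedFDeriv_zero] at hC
    refine continuousOn_of_dominated (bound := fun y => ‖φ y‖ * C) (hmeas G hG) ?_ (hint C) ?_
    · intro x hx
      filter_upwards [hmem] with y hy
      rw [norm_smul]
      exact mul_le_mul_of_nonneg_left (hC _ ⟨hx, hy⟩) (norm_nonneg _)
    · filter_upwards [hmem] with y hy
      exact continuousOn_const.smul (hG.comp (by fun_prop) fun x hx => ⟨hx, hy⟩)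
  | succ k ih =>
    let L : ((Rn n × Rn n) →L[ℝ] V) →L[ℝ] (Rn n →L[ℝ] V) :=
      (ContinuousLinearMap.compL ℝ (Rn n) (Rn n × Rn n) V).flip
        (ContinuousLinearMap.inl ℝ (Rn n) (Rn n))
    let G' : Rn n × Rn n → (Rn n →L[ℝ] V) := fun z => L (fderiv ℝ G z)
    have hfd : ContDiffOn ℝ k (fderiv ℝ G) (U ×ˢ U) :=
      hG.fderiv_of_isOpen hUU (by push_cast; exact le_rfl)
    have hG' : ContDiffOn ℝ k G' (U ×ˢ U) := L.contDiff.comp_contDiffOn hfd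
    have hb' : ∀ j ≤ k, ∃ C, ∀ z ∈ U ×ˢ U, ‖iteratedFDeriv ℝ j G' z‖ ≤ C := by
      intro j hj
      obtain ⟨C, hC⟩ := hb (j + 1) (by omega)
      refine ⟨‖L‖ * C, fun z hz => ?_⟩
      refine (L.norm_iteratedFDeriv_comp_left (hfd.contDiffAt (hUU.mem_nhds hz))
        (by exact_mod_cast hj)).trans ?_
      refine mul_le_mul_of_nonneg_left ?_ (norm_nonneg _)
      rw [norm_iteratedFDeriv_fderiv]
      exact hC z hz
    have hGd : ∀ z ∈ U ×ˢ U, HasFDerivAt G (fderiv ℝ G z) z := fun z hz =>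
      ((hG.differentiableOn (by simp) z hz).differentiableAt (hUU.mem_nhds hz)).hasFDerivAt
    obtain ⟨C, hC⟩ := hb' 0 (Nat.zero_le _)
    obtain ⟨C₀, hC₀⟩ := hb 0 (Nat.zero_le _)
    simp only [norm_iteratedFDeriv_zero] at hC hC₀
    have hder : ∀ x ∈ U, HasFDerivAt (fun x => ∫ y in U, φ y • G (x, y))
        (∫ y in U, φ y • G' (x, y)) x := by
      intro x hx
      refine hasFDerivAt_integral_of_dominated_of_fderiv_le
        (F := fun x y => φ y • G (x, y)) (F' := fun x y => φ y • G' (x, y))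
        (bound := fun y => ‖φ y‖ * C) (hU.mem_nhds hx) ?_ ?_ ?_ ?_ (hint C) ?_
      · filter_upwards [hU.mem_nhds hx] with x' hx' using hmeas G hG.continuousOn x' hx'
      · refine (hint C₀).mono' (hmeas G hG.continuousOn x hx) ?_
        filter_upwards [hmem] with y hy
        rw [norm_smul]
        exact mul_le_mul_of_nonneg_left (hC₀ _ ⟨hx, hy⟩) (norm_nonneg _)
      · exact hmeas G' hG'.continuousOn x hx
      · filter_upwards [hmem] with y hy x' hx'
        rw [norm_smul]
        exact mul_le_mul_of_nonneg_left (hC _ ⟨hx', hy⟩) (norm_nonneg _)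
      · filter_upwards [hmem] with y hy x' hx'
        have h1 : HasFDerivAt (fun x : Rn n => (x, y)) (ContinuousLinearMap.inl ℝ (Rn n) (Rn n))
            x' := hasFDerivAt_prodMk_left x' y
        exact ((hGd (x', y) ⟨hx', hy⟩).comp x' h1).const_smul (φ y)
    have h2 : EqOn (fderiv ℝ fun x => ∫ y in U, φ y • G (x, y))
        (fun x => ∫ y in U, φ y • G' (x, y)) U := fun x hx => (hder x hx).fderiv
    push_cast
    rw [contDiffOn_succ_iff_fderiv_of_isOpen hU]
    exact ⟨fun x hx => (hder x hx).differentiableAt.differentiableWithinAt, by simp,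
      (ih hG' hb').congr h2⟩

variable {Ω : Set (Rn n)} {K : Rn n × Rn n → ℝ} {ev : ℕ → ℝ} {φ : ℕ → Rn n → ℝ} {k : ℕ}

lemma IsCk.exists_norm_iteratedFDeriv_le (hΩ : IsCompact Ω) (hCk : IsCk k (Ω ×ˢ Ω) K) {j : ℕ}
    (hj : j ≤ k) : ∃ C, ∀ z ∈ interior Ω ×ˢ interior Ω, ‖iteratedFDeriv ℝ j K z‖ ≤ C := by
  obtain ⟨g, hg, hgK⟩ := hCk.2.2 j hj
  obtain ⟨C, hC⟩ := (hΩ.prod hΩ).exists_bound_of_continuousOn hg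
  rw [interior_prod_eq] at hgK
  exact ⟨C, fun z hz => by
    rw [← hgK hz]
    exact hC z ⟨interior_subset hz.1, interior_subset hz.2⟩⟩

theorem contDiffOn_eigenfunction (hΩ : IsCompact Ω) (hbd : volume (frontier Ω) = 0)
    (hCk : IsCk k (Ω ×ˢ Ω) K) (hev : IsPositiveEigensystem Ω K ev φ) (i : ℕ) (hi : 0 < ev i) :
    ContDiffOn ℝ k (φ i) (interior Ω) := by
  have hc := hCk.2.1
  rw [interior_prod_eq] at hc
  have hφ : IntegrableOn (φ i) (interior Ω) :=
    ((hev.continuousOn i hi).integrableOn_compact hΩ).mono_set interior_subset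
  have h1 := contDiffOn_integral_smul isOpen_interior hφ k hc fun j hj =>
    hCk.exists_norm_iteratedFDeriv_le hΩ hj
  have hae : interior Ω =ᵐ[volume] Ω := by
    refine interior_ae_eq_of_null_frontier hbd
  refine (contDiffOn_const (c := (ev i)⁻¹) |>.mul h1).congr fun x hx => ?_
  have h2 := hev.eigen i hi x (interior_subset hx)
  rw [setIntegral_congr_set hae]
  simp only [smul_eq_mul, mul_comm (φ i _)]
  rw [eq_inv_mul_iff_mul_eq₀ hi.ne', ← h2, integralOp]

theorem contDiffOn_mercerResidual (hΩ : IsCompact Ω) (hbd : volume (frontier Ω) = 0)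
    (hCk : IsCk k (Ω ×ˢ Ω) K) (hev : IsPositiveEigensystem Ω K ev φ) (N : ℕ) :
    ContDiffOn ℝ k (mercerResidual K ev φ N) (interior Ω ×ˢ interior Ω) := by
  have hc := hCk.2.1
  rw [interior_prod_eq] at hc
  refine hc.sub (ContDiffOn.sum fun i _ => ?_)
  by_cases hi : 0 < ev i
  · have h := contDiffOn_eigenfunction hΩ hbd hCk hev i hi
    have h1 : ContDiffOn ℝ k (fun z : Rn n × Rn n => φ i z.1) (interior Ω ×ˢ interior Ω) :=
      h.comp contDiffOn_fst fun z hz => hz.1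
    have h2 : ContDiffOn ℝ k (fun z : Rn n × Rn n => φ i z.2) (interior Ω ×ˢ interior Ω) :=
      h.comp contDiffOn_snd fun z hz => hz.2
    exact (contDiffOn_const.mul h1).mul h2
  · simp only [hev.mul_eq_zero_of_not_pos hi, zero_mul]
    exact contDiffOn_const

end ParametricIntegral

section ProductNorm

lemma eLpNorm_mul_prod_le {X Y : Type*} [MeasurableSpace X] [MeasurableSpace Y] {μ : Measure X}
    {ν : Measure Y} [SFinite μ] [SFinite ν] {a : X → ℝ} {b : Y → ℝ} (ha : AEStronglyMeasurable a μ)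
    (hb : AEStronglyMeasurable b ν) {p : ℝ≥0∞} (hp : p ≠ 0) :
    eLpNorm (fun z : X × Y => a z.1 * b z.2) p (μ.prod ν) ≤ eLpNorm a p μ * eLpNorm b p ν := by
  by_cases hp' : p = ⊤
  · subst hp'
    simp only [eLpNorm_exponent_top]
    refine eLpNormEssSup_le_of_ae_enorm_bound ?_
    filter_upwards [Measure.quasiMeasurePreserving_fst.ae (enorm_ae_le_eLpNormEssSup a μ),
      Measure.quasiMeasurePreserving_snd.ae (enorm_ae_le_eLpNormEssSup b ν)] with z h1 h2
    rw [enorm_mul]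
    exact mul_le_mul' h1 h2
  · have h0 : 0 ≤ p.toReal := ENNReal.toReal_nonneg
    simp only [eLpNorm_eq_lintegral_rpow_enorm_toReal hp hp', enorm_mul,
      ENNReal.mul_rpow_of_nonneg _ _ h0]
    rw [lintegral_prod_mul (f := fun x => ‖a x‖ₑ ^ p.toReal) (g := fun y => ‖b y‖ₑ ^ p.toReal)
      (ha.enorm.pow_const _) (hb.enorm.pow_const _), ENNReal.mul_rpow_of_nonneg]
    positivity

end ProductNorm

section InteriorNorm

variable {n : ℕ} {Ω : Set (Rn n)}

lemma prod_interior_ae_eq (hbd : volume (frontier Ω) = 0) :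
    (interior Ω ×ˢ interior Ω : Set (Rn n × Rn n)) =ᵐ[volume] Ω ×ˢ Ω :=
  Measure.set_prod_ae_eq (interior_ae_eq_of_null_frontier hbd)
    (interior_ae_eq_of_null_frontier hbd)

lemma restrict_prod_eq (hbd : volume (frontier Ω) = 0) :
    (volume : Measure (Rn n × Rn n)).restrict (Ω ×ˢ Ω) =
      volume.restrict (interior Ω ×ˢ interior Ω) :=
  (Measure.restrict_congr_set (prod_interior_ae_eq hbd)).symm

lemma enorm_le_eLpNorm_top {u : Rn n × Rn n → ℝ} (hcl : Ω ⊆ closure (interior Ω))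
    (hu : ContinuousOn u (Ω ×ˢ Ω)) {z : Rn n × Rn n} (hz : z ∈ Ω ×ˢ Ω) :
    ‖u z‖ₑ ≤ eLpNorm u ⊤ (volume.restrict (Ω ×ˢ Ω)) := by
  set c := eLpNorm u ⊤ (volume.restrict (Ω ×ˢ Ω)) with hc
  set W : Set (Rn n × Rn n) := interior Ω ×ˢ interior Ω with hW
  have hWsub : W ⊆ Ω ×ˢ Ω := prod_mono interior_subset interior_subset
  have huW := hu.mono hWsub
  have h1 : (fun z => ‖u z‖ₑ) =ᵐ[volume.restrict W] fun z => min ‖u z‖ₑ c := by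
    refine ae_restrict_of_ae_restrict_of_subset hWsub ?_
    filter_upwards [enorm_ae_le_eLpNormEssSup u (volume.restrict (Ω ×ˢ Ω))] with z hz
    rw [hc, eLpNorm_exponent_top, min_eq_left hz]
  have h2 : EqOn (fun z => ‖u z‖ₑ) (fun z => min ‖u z‖ₑ c) W :=
    Measure.eqOn_open_of_ae_eq h1 (isOpen_interior.prod isOpen_interior) huW.enorm
      (huW.enorm.inf continuousOn_const)
  have hzW : z ∈ closure W := by
    rw [hW, closure_prod_eq]
    exact ⟨hcl hz.1, hcl hz.2⟩
  have : (nhdsWithin z W).NeBot := mem_closure_iff_nhdsWithin_neBot.1 hzW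
  have hlim : Filter.Tendsto (fun z => ‖u z‖ₑ) (nhdsWithin z W) (nhds ‖u z‖ₑ) :=
    ((hu z hz).mono hWsub).enorm
  refine le_of_tendsto hlim ?_
  filter_upwards [self_mem_nhdsWithin] with w hw
  have h3 := h2 hw
  simp only at h3
  rw [h3]
  exact min_le_right _ _

end InteriorNorm

section DerivativeBound

variable {n : ℕ} {Ω : Set (Rn n)} {K R : Rn n × Rn n → ℝ}

lemma eventually_zonotope_subset {W : Set (Rn n)} (hW : IsOpen W) (l : List (Rn n)) {x : Rn n}
    (hx : x ∈ W) : ∀ᶠ h : ℝ in nhdsWithin 0 (Ioi 0),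
      zonotope (l.map fun e => h • e) x ⊆ W := by
  obtain ⟨r, hr, hrW⟩ := Metric.isOpen_iff.1 hW x hx
  set S := (l.map fun e => ‖e‖).sum with hS
  have hS0 : 0 ≤ S := List.sum_nonneg (by simp)
  have hpos : 0 < r / (S + 1) := by positivity
  filter_upwards [Ioo_mem_nhdsGT hpos] with h hh
  refine (zonotope_subset_closedBall _ _).trans ((Metric.closedBall_subset_ball ?_).trans hrW)
  have : (List.map (fun e => ‖e‖) (List.map (fun e => h • e) l)).sum = h * S := by
    rw [hS, List.map_map, ← List.sum_map_mul_left]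
    congr 1
    refine List.map_congr_left fun e _ => ?_
    simp [norm_smul, abs_of_pos hh.1]
  rw [this]
  have h2 := (lt_div_iff₀ (by positivity)).1 hh.2
  nlinarith [hh.1]

lemma prodDirs_map_smul (h : ℝ) (l l' : List (Rn n)) :
    (prodDirs l l').map (fun e => h • e) =
      prodDirs (l.map fun e => h • e) (l'.map fun e => h • e) := by
  simp [prodDirs, Function.comp_def]

lemma tendsto_kernelForm_diffFunctional {W : Set (Rn n)} (hW : IsOpen W) (l l' : List (Rn n))
    (hR : ContDiffOn ℝ ((l.length + l'.length : ℕ) : ℕ∞ω) R (W ×ˢ W)) {x y : Rn n} (hx : x ∈ W)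
    (hy : y ∈ W) :
    Filter.Tendsto (fun h : ℝ => kernelForm R (diffFunctional (l.map fun e => h • e) x)
      (diffFunctional (l'.map fun e => h • e) y) / (h ^ l.length * h ^ l'.length))
      (nhdsWithin 0 (Ioi 0)) (nhds (dirDeriv (prodDirs l l') R (x, y))) := by
  have := tendsto_finDiff (hW.prod hW) (prodDirs l l') (f := R)
    (by rwa [length_prodDirs]) (z := (x, y)) ⟨hx, hy⟩
  simpa only [prodDirs_map_smul, finDiff_eq_kernelForm, length_prodDirs, pow_add] using this

lemma dirDeriv_diag_nonneg {W : Set (Rn n)} (hW : IsOpen W) (hK : IsPSDKernelOn W K)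
    (l : List (Rn n)) (hKd : ContDiffOn ℝ ((l.length + l.length : ℕ) : ℕ∞ω) K (W ×ˢ W)) {x : Rn n}
    (hx : x ∈ W) : 0 ≤ dirDeriv (prodDirs l l) K (x, x) := by
  refine ge_of_tendsto (tendsto_kernelForm_diffFunctional hW l l hKd hx hx) ?_
  filter_upwards [eventually_zonotope_subset hW l hx] with h hh
  exact div_nonneg (hK.nonneg _ ((support_diffFunctional _ _).trans hh)) (mul_self_nonneg _)

/-- Mixed derivatives of a positive semidefinite kernel `R` that is dominated by `K` are controlled
by the diagonal derivatives of `K`. -/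
theorem dirDeriv_sq_le {W : Set (Rn n)} (hW : IsOpen W) (hR : IsPSDKernelOn W R)
    (hRK : ∀ L : Rn n →₀ ℝ, kernelForm R L L ≤ kernelForm K L L) (l l' : List (Rn n))
    (hRd : ContDiffOn ℝ ((l.length + l'.length : ℕ) : ℕ∞ω) R (W ×ˢ W))
    (hKd : ContDiffOn ℝ ((l.length + l.length : ℕ) : ℕ∞ω) K (W ×ˢ W))
    (hKd' : ContDiffOn ℝ ((l'.length + l'.length : ℕ) : ℕ∞ω) K (W ×ˢ W)) {x y : Rn n}
    (hx : x ∈ W) (hy : y ∈ W) :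
    dirDeriv (prodDirs l l') R (x, y) ^ 2 ≤
      dirDeriv (prodDirs l l) K (x, x) * dirDeriv (prodDirs l' l') K (y, y) := by
  refine le_of_tendsto_of_tendsto ((tendsto_kernelForm_diffFunctional hW l l' hRd hx hy).pow 2)
    ((tendsto_kernelForm_diffFunctional hW l l hKd hx hx).mul
      (tendsto_kernelForm_diffFunctional hW l' l' hKd' hy hy)) ?_
  filter_upwards [eventually_zonotope_subset hW l hx, eventually_zonotope_subset hW l' hy,
    self_mem_nhdsWithin] with h hh hh' hpos
  have hpos' : (0 : ℝ) < h := hpos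
  have h1 := (support_diffFunctional (l.map fun e => h • e) x).trans hh
  have h2 := (support_diffFunctional (l'.map fun e => h • e) y).trans hh'
  have h3 := hR.form_sq_le h1 h2
  have h4 := mul_le_mul (hRK (diffFunctional (l.map fun e => h • e) x))
    (hRK (diffFunctional (l'.map fun e => h • e) y)) (hR.nonneg _ h2)
    ((hR.nonneg _ h1).trans (hRK _))
  simp only [div_pow, div_mul_div_comm]
  rw [show h ^ l.length * h ^ l.length * (h ^ l'.length * h ^ l'.length) =
    (h ^ l.length * h ^ l'.length) ^ 2 by ring]
  exact div_le_div_of_nonneg_right (h3.trans h4) (sq_nonneg _)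

end DerivativeBound

section GagliardoNirenberg

lemma IsPSDKernelOn.mono {X : Type*} {Ω W : Set X} {R : X × X → ℝ} (hR : IsPSDKernelOn Ω R)
    (h : W ⊆ Ω) : IsPSDKernelOn W R where
  symm x hx y hy := hR.symm x (h hx) y (h hy)
  nonneg L hL := hR.nonneg L (hL.trans h)

variable {n : ℕ} {Ω : Set (Rn n)} {K : Rn n × Rn n → ℝ} {ev : ℕ → ℝ} {φ : ℕ → Rn n → ℝ} {k m : ℕ}

lemma diagDeriv_eq (K : Rn n × Rn n → ℝ) (α : Fin n → ℕ) (x : Rn n) :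
    diagDeriv K α x = dirDeriv (prodDirs (coordDirs α) (coordDirs α)) K (x, x) := by
  rw [diagDeriv, mixedDeriv_eq_dirDeriv]

lemma prod_norm_prodDirs_coordDirs (α β : Fin n → ℕ) :
    ((prodDirs (coordDirs α) (coordDirs β)).map fun e => ‖e‖).prod = 1 := by
  refine List.prod_eq_one fun x hx => ?_
  simp only [prodDirs, coordDirs, multiDirs, List.mem_map, List.mem_append, List.mem_flatMap,
    List.mem_replicate] at hx
  obtain ⟨e, ⟨v, ⟨i, -, -, rfl⟩, rfl⟩ | ⟨v, ⟨i, -, -, rfl⟩, rfl⟩, rfl⟩ := hx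
  · simp
  · simp

lemma exists_diagDeriv_le (hΩ : IsCompact Ω) (hCk : IsCk (2 * m) (Ω ×ˢ Ω) K) :
    ∃ C : ℝ, 0 ≤ C ∧ ∀ α : Fin n → ℕ, multiLength α ≤ m → ∀ x ∈ interior Ω,
      diagDeriv K α x ≤ C := by
  choose! C hC using fun (j : ℕ) (hj : j ≤ 2 * m) => hCk.exists_norm_iteratedFDeriv_le hΩ hj
  refine ⟨∑ j ∈ Finset.range (2 * m + 1), |C j|, Finset.sum_nonneg fun _ _ => abs_nonneg _,
    fun α hα x hx => ?_⟩
  have hlen : (prodDirs (coordDirs α) (coordDirs α)).length = multiLength α + multiLength α := by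
    rw [length_prodDirs, length_coordDirs]
  have hc := hCk.2.1
  rw [interior_prod_eq] at hc
  have h1 := abs_dirDeriv_le (isOpen_interior.prod isOpen_interior)
    (prodDirs (coordDirs α) (coordDirs α)) (f := K) (z := (x, x))
    (hc.of_le (by rw [hlen]; norm_cast; omega)) ⟨hx, hx⟩
  rw [prod_norm_prodDirs_coordDirs, mul_one, hlen] at h1
  rw [diagDeriv_eq]
  refine (le_abs_self _).trans (h1.trans ((hC _ (by omega) _ ⟨hx, hx⟩).trans ?_))
  refine (le_abs_self _).trans (Finset.single_le_sum (f := fun j => |C j|)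
    (fun _ _ => abs_nonneg _) (Finset.mem_range.2 (by omega)))

lemma continuousOn_diagDeriv (hCk : IsCk (2 * m) (Ω ×ˢ Ω) K) {α : Fin n → ℕ}
    (hα : multiLength α ≤ m) : ContinuousOn (diagDeriv K α) (interior Ω) := by
  have hc := hCk.2.1
  rw [interior_prod_eq] at hc
  have h1 : ContDiffOn ℝ ((0 : ℕ) : ℕ∞ω) (dirDeriv (prodDirs (coordDirs α) (coordDirs α)) K)
      (interior Ω ×ˢ interior Ω) := by
    refine contDiffOn_dirDeriv (isOpen_interior.prod isOpen_interior) _ (hc.of_le ?_)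
    rw [length_prodDirs, length_coordDirs]
    norm_cast
    omega
  have h2 := h1.continuousOn.comp (f := fun x : Rn n => (x, x)) (by fun_prop)
    (fun x (hx : x ∈ interior Ω) => ⟨hx, hx⟩)
  exact h2.congr fun x _ => diagDeriv_eq K α x

lemma aestronglyMeasurable_sqrt_diagDeriv (hbd : volume (frontier Ω) = 0)
    (hCk : IsCk (2 * m) (Ω ×ˢ Ω) K) {α : Fin n → ℕ} (hα : multiLength α ≤ m) :
    AEStronglyMeasurable (fun x => √(diagDeriv K α x)) (volume.restrict Ω) := by
  rw [← Measure.restrict_congr_set (interior_ae_eq_of_null_frontier hbd)]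
  exact (continuousOn_diagDeriv hCk hα).sqrt.aestronglyMeasurable
    isOpen_interior.measurableSet

lemma abs_mixedDeriv_mercerResidual_le (hΩ : IsCompact Ω) (hbd : volume (frontier Ω) = 0)
    (hK : IsPSDKernelOn Ω K) (hc : ContinuousOn K (Ω ×ˢ Ω)) (hCk : IsCk (2 * m) (Ω ×ˢ Ω) K)
    (hev : IsPositiveEigensystem Ω K ev φ) (N : ℕ) {α β : Fin n → ℕ}
    (hαβ : multiLength α + multiLength β = m) {x y : Rn n} (hx : x ∈ interior Ω)
    (hy : y ∈ interior Ω) : |mixedDeriv α β (mercerResidual K ev φ N) (x, y)| ≤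
      √(diagDeriv K α x) * √(diagDeriv K β y) := by
  have hKd := hCk.2.1
  rw [interior_prod_eq] at hKd
  have hRd := contDiffOn_mercerResidual hΩ hbd hCk hev N
  have hKd' : ∀ γ : Fin n → ℕ, multiLength γ ≤ m → ContDiffOn ℝ
      (((coordDirs γ).length + (coordDirs γ).length : ℕ) : ℕ∞ω) K
      (interior Ω ×ˢ interior Ω) := fun γ hγ => by
    refine hKd.of_le ?_
    rw [length_coordDirs]
    norm_cast
    omega
  have hα : multiLength α ≤ m := by omega
  have hβ : multiLength β ≤ m := by omega
  have h1 := dirDeriv_sq_le isOpen_interior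
    ((isPSDKernelOn_mercerResidual hΩ hc hK hev N).mono interior_subset)
    (kernelForm_mercerResidual_le hev N) (coordDirs α) (coordDirs β)
    (hRd.of_le (by rw [length_coordDirs, length_coordDirs]; norm_cast; omega))
    (hKd' α hα) (hKd' β hβ) hx hy
  rw [← mixedDeriv_eq_dirDeriv, ← diagDeriv_eq, ← diagDeriv_eq] at h1
  have h2 : 0 ≤ diagDeriv K α x := by
    rw [diagDeriv_eq]
    exact dirDeriv_diag_nonneg isOpen_interior (hK.mono interior_subset) _ (hKd' α hα) hx
  rw [← Real.sqrt_mul h2]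
  exact Real.abs_le_sqrt h1

lemma eLpNorm_le_gnConst_mul {p : ℝ≥0∞} {t : ℝ} (ht0 : 0 ≤ t) (ht1 : t ≤ 1)
    {u : Rn n × Rn n → ℝ} {v : (Fin n → ℕ) → (Fin n → ℕ) → Rn n × Rn n → ℝ}
    (hu2 : MemLp u 2 (volume.restrict (Ω ×ˢ Ω))) (hup : MemLp u p (volume.restrict (Ω ×ˢ Ω)))
    (hv : ∀ α β, multiLength α + multiLength β = m →
      IsWeakMixedDeriv Ω α β u (v α β) ∧ MemLp (v α β) p (volume.restrict (Ω ×ˢ Ω)))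
    {B : ℝ≥0∞} (hB : B ≠ ⊤) (hvB : ∀ α β, multiLength α + multiLength β = m →
      eLpNorm (v α β) p (volume.restrict (Ω ×ˢ Ω)) ≤ B) :
    eLpNorm u ⊤ (volume.restrict (Ω ×ˢ Ω)) ≤ gnConst Ω m p t *
      (eLpNorm u 2 (volume.restrict (Ω ×ˢ Ω)) ^ (1 - t) *
      (⨆ (α : Fin n → ℕ) (β : Fin n → ℕ) (_ : multiLength α + multiLength β = m),
        eLpNorm (v α β) p (volume.restrict (Ω ×ˢ Ω))) ^ t +
      eLpNorm u 2 (volume.restrict (Ω ×ˢ Ω))) := by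
  by_cases h0 : u =ᵐ[volume.restrict (Ω ×ˢ Ω)] 0
  · rw [eLpNorm_congr_ae h0, eLpNorm_zero]
    exact zero_le
  have hratio : gnRatio Ω m p t u v ≤ gnConst Ω m p t :=
    le_iSup_of_le u <| le_iSup_of_le v <| le_iSup_of_le hu2 <| le_iSup_of_le hup <|
      le_iSup_of_le h0 <| le_iSup_of_le hv le_rfl
  have hne : eLpNorm u 2 (volume.restrict (Ω ×ˢ Ω)) ≠ 0 := fun h =>
    h0 ((eLpNorm_eq_zero_iff hu2.1 (by norm_num)).1 h)
  have hM : (⨆ (α : Fin n → ℕ) (β : Fin n → ℕ) (_ : multiLength α + multiLength β = m),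
      eLpNorm (v α β) p (volume.restrict (Ω ×ˢ Ω))) ≠ ⊤ :=
    ne_top_of_le_ne_top hB (iSup_le fun α => iSup_le fun β => iSup_le fun h => hvB α β h)
  refine (ENNReal.div_le_iff_le_mul (Or.inl ?_) (Or.inl ?_)).1 hratio
  · exact fun h => hne (add_eq_zero.1 h).2
  · exact ENNReal.add_ne_top.2 ⟨ENNReal.mul_ne_top
      (ENNReal.rpow_ne_top_of_nonneg (by linarith) hu2.2.ne)
      (ENNReal.rpow_ne_top_of_nonneg ht0 hM), hu2.2.ne⟩

theorem mercerError_le_gnBound (hn : 1 ≤ n) (hΩ : IsCompact Ω) (hLip : HasLipschitzBoundary Ω)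
    (hK : IsMercerKernel Ω K) (hCk : IsCk (2 * m) (Ω ×ˢ Ω) K)
    (hev : IsPositiveEigensystem Ω K ev φ) {p : ℝ≥0∞} (hp : 1 ≤ p) {t : ℝ} (ht0 : 0 ≤ t)
    (ht1 : t ≤ 1) (N : ℕ) : mercerError Ω K ev φ N ≤ gnBound Ω K ev m p t N := by
  have hbd := volume_frontier_eq_zero hΩ.isClosed hLip
  have hcl := subset_closure_interior hLip
  have hc := hK.continuousOn
  have hpsd := hK.isPSDKernelOn
  have hp0 : p ≠ 0 := (zero_lt_one.trans_le hp).ne'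
  set ν : Measure (Rn n × Rn n) := volume.restrict (Ω ×ˢ Ω) with hν
  have hfin : IsFiniteMeasure ν := ⟨by simpa [hν] using (hΩ.prod hΩ).measure_lt_top⟩
  set u := mercerResidual K ev φ N with hu
  have huc : ContinuousOn u (Ω ×ˢ Ω) := continuousOn_mercerResidual hc hev N
  have hmem : ∀ q, MemLp u q ν := memLp_restrict_of_continuousOn (hΩ.prod hΩ) huc
  obtain ⟨C, hC0, hC⟩ := exists_diagDeriv_le (m := m) hΩ hCk
  have hud := contDiffOn_mercerResidual hΩ hbd hCk hev N
  have hint : ∀ᵐ z ∂ν, z ∈ interior Ω ×ˢ interior Ω := by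
    rw [hν, restrict_prod_eq hbd]
    exact ae_restrict_mem (isOpen_interior.prod isOpen_interior).measurableSet
  have hab : ∀ α β, multiLength α + multiLength β = m → ∀ᵐ z ∂ν,
      ‖mixedDeriv α β u z‖ ≤ √(diagDeriv K α z.1) * √(diagDeriv K β z.2) := by
    intro α β hαβ
    filter_upwards [hint] with z hz
    exact abs_mixedDeriv_mercerResidual_le hΩ hbd hpsd hc hCk hev N hαβ hz.1 hz.2
  have habC : ∀ α β, multiLength α + multiLength β = m → ∀ᵐ z ∂ν, ‖mixedDeriv α β u z‖ ≤ C := by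
    intro α β hαβ
    filter_upwards [hab α β hαβ, hint] with z hz hzi
    refine hz.trans ?_
    rw [← Real.mul_self_sqrt hC0]
    exact mul_le_mul (Real.sqrt_le_sqrt (hC α (by omega) _ hzi.1))
      (Real.sqrt_le_sqrt (hC β (by omega) _ hzi.2)) (Real.sqrt_nonneg _) (Real.sqrt_nonneg _)
  have hvm : ∀ α β, multiLength α + multiLength β = m →
      AEStronglyMeasurable (mixedDeriv α β u) ν := by
    intro α β hαβ
    rw [hν, restrict_prod_eq hbd, mixedDeriv_eq_dirDeriv]
    refine ContinuousOn.aestronglyMeasurable ?_ (isOpen_interior.prod isOpen_interior).measurableSet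
    refine (contDiffOn_dirDeriv (isOpen_interior.prod isOpen_interior) _ (k := 0)
      (hud.of_le ?_)).continuousOn
    rw [length_prodDirs, length_coordDirs, length_coordDirs]
    norm_cast
    omega
  have hv : ∀ α β, multiLength α + multiLength β = m →
      IsWeakMixedDeriv Ω α β u (mixedDeriv α β u) ∧ MemLp (mixedDeriv α β u) p ν := by
    refine fun α β hαβ => ⟨isWeakMixedDeriv_mixedDeriv ?_,
      MemLp.of_bound (hvm α β hαβ) C (habC α β hαβ)⟩
    rw [interior_prod_eq]
    refine hud.of_le ?_
    norm_cast
    omega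
  have hB : ν univ ^ p.toReal⁻¹ * ENNReal.ofReal C ≠ ⊤ :=
    ENNReal.mul_ne_top (ENNReal.rpow_ne_top_of_nonneg (by positivity) (measure_ne_top _ _))
      ENNReal.ofReal_ne_top
  have hprod : ∀ α β, multiLength α + multiLength β = m → eLpNorm (mixedDeriv α β u) p ν ≤
      eLpNorm (fun x => √(diagDeriv K α x)) p (volume.restrict Ω) *
        eLpNorm (fun x => √(diagDeriv K β x)) p (volume.restrict Ω) := by
    intro α β hαβ
    refine (eLpNorm_mono_ae_real (hab α β hαβ)).trans ?_
    have := eLpNorm_mul_prod_le (aestronglyMeasurable_sqrt_diagDeriv hbd hCk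
      (α := α) (by omega)) (aestronglyMeasurable_sqrt_diagDeriv hbd hCk (α := β) (by omega)) hp0
    rw [Measure.prod_restrict] at this
    exact this
  have hL2 : eLpNorm u 2 ν ≤ sqTail ev N ^ ((1 : ℝ) / 2) := by
    rw [eLpNorm_eq_lintegral_rpow_enorm_toReal (by norm_num) (by norm_num)]
    simp only [ENNReal.toReal_ofNat]
    refine ENNReal.rpow_le_rpow ?_ (by norm_num)
    refine le_trans (le_of_eq ?_) (lintegral_mercerResidual_sq_le hΩ hbd hc hpsd hev N)
    rw [hν, Measure.volume_eq_prod, ← Measure.prod_restrict, lintegral_prod]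
    · simp [hu]
    · rw [Measure.prod_restrict]
      exact ((huc.aestronglyMeasurable (hΩ.prod hΩ).measurableSet).enorm.pow_const _)
  have hGN := eLpNorm_le_gnConst_mul ht0 ht1 (hmem 2) (hmem p) hv hB fun α β hαβ =>
    eLpNorm_le_of_ae_bound (habC α β hαβ)
  have herr : mercerError Ω K ev φ N ≤ eLpNorm u ⊤ ν := by
    rw [mercerError_eq]
    exact iSup₂_le fun x hx => iSup₂_le fun y hy => enorm_le_eLpNorm_top hcl huc ⟨hx, hy⟩
  refine herr.trans (hGN.trans ?_)
  rw [gnBound, mul_add, ← mul_assoc]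
  refine add_le_add (mul_le_mul' (mul_le_mul' le_rfl ?_) ?_) (mul_le_mul' le_rfl hL2)
  · refine (ENNReal.rpow_le_rpow hL2 (by linarith)).trans_eq ?_
    rw [← ENNReal.rpow_mul]
    congr 1
    ring
  · have hle : ∀ α β, multiLength α + multiLength β = m →
        (eLpNorm (mixedDeriv α β u) p ν) ^ t ≤
        ⨆ (α : Fin n → ℕ) (β : Fin n → ℕ) (_ : multiLength α + multiLength β = m),
          eLpNorm (fun x => √(diagDeriv K α x)) p (volume.restrict Ω) ^ t *
          eLpNorm (fun x => √(diagDeriv K β x)) p (volume.restrict Ω) ^ t := by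
      intro α β hαβ
      refine le_iSup_of_le α <| le_iSup_of_le β <| le_iSup_of_le hαβ ?_
      rw [← ENNReal.mul_rpow_of_nonneg _ _ ht0]
      exact ENNReal.rpow_le_rpow (hprod α β hαβ) ht0
    rcases ht0.eq_or_lt with rfl | ht
    · have h1 := hle (Pi.single ⟨0, hn⟩ m) 0 (by simp [multiLength])
      rw [ENNReal.rpow_zero] at h1 ⊢
      exact h1
    · rw [← ENNReal.le_rpow_inv_iff ht]
      refine iSup_le fun α => iSup_le fun β => iSup_le fun hαβ => ?_
      rw [ENNReal.le_rpow_inv_iff ht]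
      exact hle α β hαβ

end GagliardoNirenberg

section DiagonalBound

variable {n : ℕ} {Ω : Set (Rn n)} {K R : Rn n × Rn n → ℝ} {m : ℕ}

lemma kernelForm_diffFunctional_replicate_le {W : Set (Rn n)} (hW : IsOpen W)
    (hKd : ContDiffOn ℝ ((2 * m : ℕ) : ℕ∞ω) K (W ×ˢ W)) {C : ℝ} (hC0 : 0 ≤ C)
    (hC : ∀ z ∈ W ×ˢ W, ‖iteratedFDeriv ℝ (2 * m) K z‖ ≤ C) {y h : Rn n} {ε : ℝ}
    (hh : ‖h‖ ≤ 2 * ε) (hz : zonotope (List.replicate m h) y ⊆ W) :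
    kernelForm K (diffFunctional (List.replicate m h) y) (diffFunctional (List.replicate m h) y) ≤
      C * 4 ^ m * ε ^ (2 * m) := by
  set l := prodDirs (List.replicate m h) (List.replicate m h) with hl
  have hlen : l.length = 2 * m := by rw [hl, length_prodDirs, List.length_replicate]; ring
  obtain ⟨w, hw, hw'⟩ := exists_finDiff_eq_dirDeriv (hW.prod hW) l (f := K) (by rwa [hlen]) (y, y)
    ((zonotope_prodDirs_subset _ _ _ _).trans (prod_mono hz hz))
  have hwW := (zonotope_prodDirs_subset _ _ _ _).trans (prod_mono hz hz) hw
  rw [← finDiff_eq_kernelForm, hw']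
  refine (le_abs_self _).trans ((abs_dirDeriv_le (hW.prod hW) l.reverse
    (by rwa [List.length_reverse, hlen]) hwW).trans ?_)
  have hprod : (l.reverse.map fun e => ‖e‖).prod = ‖h‖ ^ (2 * m) := by
    rw [List.map_reverse, List.prod_reverse, hl]
    simp [prodDirs, two_mul, pow_add]
  rw [hprod, List.length_reverse, hlen]
  calc _ ≤ C * (2 * ε) ^ (2 * m) :=
        mul_le_mul (hC w hwW) (pow_le_pow_left₀ (norm_nonneg _) hh _) (by positivity) hC0
    _ = C * 4 ^ m * ε ^ (2 * m) := by
        rw [mul_pow, pow_mul 2 2 m]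
        norm_num
        ring

/-- The diagonal value of a positive semidefinite kernel is bounded by its form on differences and
its values at shifted points. -/
theorem exists_diag_sq_le (m : ℕ) : ∃ C : ℝ, 0 ≤ C ∧ ∀ (Ω : Set (Rn n)) (R : Rn n × Rn n → ℝ),
    IsPSDKernelOn Ω R → ∀ (y h h' : Rn n) (δ : ℝ), 0 ≤ δ → y ∈ Ω →
    zonotope (List.replicate m h) y ⊆ Ω → zonotope (List.replicate m h') y ⊆ Ω →
    kernelForm R (diffFunctional (List.replicate m h) y)
      (diffFunctional (List.replicate m h) y) ≤ δ →
    kernelForm R (diffFunctional (List.replicate m h') y)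
      (diffFunctional (List.replicate m h') y) ≤ δ →
    R (y, y) ^ 2 ≤ 72 * δ ^ 2 + C * ∑ i ∈ Finset.range m, ∑ j ∈ Finset.range m,
      R (y + ((i + 1 : ℕ) : ℝ) • h, y + ((j + 1 : ℕ) : ℝ) • h') ^ 2 := by
  obtain ⟨c, hc⟩ := exists_diffFunctional_replicate_eq (E := Rn n) m
  refine ⟨8 * ∑ z ∈ Finset.range m ×ˢ Finset.range m, (c z.1 * c z.2) ^ 2, by positivity, ?_⟩
  intro Ω R hR y h h' δ hδ hy hz hz' hL hL'
  set L := diffFunctional (List.replicate m h) y with hLdef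
  set L' := diffFunctional (List.replicate m h') y with hLdef'
  have hLΩ : (L.support : Set (Rn n)) ⊆ Ω := (support_diffFunctional _ _).trans hz
  have hLΩ' : (L'.support : Set (Rn n)) ⊆ Ω := (support_diffFunctional _ _).trans hz'
  set A := ∑ j ∈ Finset.range m, c j • Finsupp.single (y + ((j + 1 : ℕ) : ℝ) • h) (1 : ℝ) with hA
  set A' := ∑ j ∈ Finset.range m, c j • Finsupp.single (y + ((j + 1 : ℕ) : ℝ) • h') (1 : ℝ)
    with hA'
  set s : ℝ := (-1) ^ m with hs
  have hs2 : s * s = 1 := by rw [hs, ← mul_pow]; norm_num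
  set d : Rn n →₀ ℝ := Finsupp.single y 1 with hd
  have hdΩ : (d.support : Set (Rn n)) ⊆ Ω := support_single_subset hy 1
  have hAL : A = L - s • d := by rw [hLdef, hc]; abel
  have hAL' : A' = L' - s • d := by rw [hLdef', hc]; abel
  have hRy : kernelForm R d d = R (y, y) := by simp [hd, kernelForm_single]
  have hR0 : 0 ≤ R (y, y) := hR.diag_nonneg hy
  have hid : R (y, y) = -kernelForm R L L' + s * kernelForm R L d + s * kernelForm R d L' +
      kernelForm R A A' := by
    rw [hAL, hAL', kernelForm_sub_left, kernelForm_sub_right, kernelForm_sub_right,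
      kernelForm_smul_left, kernelForm_smul_left, kernelForm_smul_right, kernelForm_smul_right,
      hRy]
    linear_combination (-(R (y, y))) * hs2
  have hAA : kernelForm R A A' = ∑ z ∈ Finset.range m ×ˢ Finset.range m, (c z.1 * c z.2) *
      R (y + ((z.1 + 1 : ℕ) : ℝ) • h, y + ((z.2 + 1 : ℕ) : ℝ) • h') := by
    rw [Finset.sum_product, hA, hA']
    simp only [kernelForm, map_sum, map_smul, Finsupp.linearCombination_single, smul_eq_mul,
      one_mul, Finset.mul_sum]
    refine Finset.sum_congr rfl fun i _ => Finset.sum_congr rfl fun j _ => ?_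
    ring
  have hAA2 : kernelForm R A A' ^ 2 ≤
      (∑ z ∈ Finset.range m ×ˢ Finset.range m, (c z.1 * c z.2) ^ 2) *
      ∑ i ∈ Finset.range m, ∑ j ∈ Finset.range m,
        R (y + ((i + 1 : ℕ) : ℝ) • h, y + ((j + 1 : ℕ) : ℝ) • h') ^ 2 := by
    rw [hAA]
    refine (Finset.sum_mul_sq_le_sq_mul_sq _ _ _).trans_eq ?_
    congr 1
    rw [Finset.sum_product]
  have b1 : |kernelForm R L L'| ≤ δ := by
    refine abs_le_of_sq_le_sq ?_ hδ
    refine (hR.form_sq_le hLΩ hLΩ').trans ?_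
    rw [pow_two]
    exact mul_le_mul hL hL' (hR.nonneg _ hLΩ') hδ
  have hsabs : |s| = 1 := by rw [hs, abs_pow]; simp
  have b2 : |s * kernelForm R L d| ≤ δ + R (y, y) / 4 := by
    rw [abs_mul, hsabs, one_mul]
    refine abs_le_of_sq_le_sq ?_ (by positivity)
    have h1 := hR.form_sq_le hLΩ hdΩ
    rw [hRy] at h1
    have h2 := mul_le_mul_of_nonneg_right hL hR0
    nlinarith [sq_nonneg (δ - R (y, y) / 4)]
  have b3 : |s * kernelForm R d L'| ≤ δ + R (y, y) / 4 := by
    rw [abs_mul, hsabs, one_mul]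
    refine abs_le_of_sq_le_sq ?_ (by positivity)
    have h1 := hR.form_sq_le hdΩ hLΩ'
    rw [hRy] at h1
    have h2 := mul_le_mul_of_nonneg_right hL' hR0
    nlinarith [sq_nonneg (δ - R (y, y) / 4)]
  have hle : R (y, y) ≤ 6 * δ + 2 * |kernelForm R A A'| := by
    have := le_abs_self (kernelForm R A A')
    have := (abs_le.1 b1).1
    have := (abs_le.1 b2).2
    have := (abs_le.1 b3).2
    linarith
  have hsq : R (y, y) ^ 2 ≤ (6 * δ + 2 * |kernelForm R A A'|) ^ 2 :=
    pow_le_pow_left₀ hR0 hle 2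
  have habs := sq_abs (kernelForm R A A')
  nlinarith [sq_nonneg (6 * δ - 2 * |kernelForm R A A'|)]

lemma setLIntegral_comp_add_smul_le {j : ℝ} (hj : 1 ≤ j) (y : Rn n) {B : Set (Rn n)}
    (hB : ∀ h ∈ B, y + j • h ∈ Ω) (g : Rn n → ℝ≥0∞) :
    ∫⁻ h in B, g (y + j • h) ≤ ∫⁻ x in Ω, g x := by
  have hj0 : j ≠ 0 := by positivity
  have hemb : MeasurableEmbedding fun h : Rn n => y + j • h :=
    ((Homeomorph.smulOfNeZero j hj0).trans (Homeomorph.addLeft y)).measurableEmbedding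
  have hmap : (volume : Measure (Rn n)).map (fun h : Rn n => y + j • h) ≤ volume := by
    have h1 : (fun h : Rn n => y + j • h) = (fun x => y + x) ∘ fun h => j • h := rfl
    rw [h1, ← Measure.map_map (by fun_prop) (by fun_prop), Measure.map_addHaar_smul _ hj0,
      Measure.map_smul, map_add_left_eq_self]
    refine Measure.le_iff.2 fun s _ => ?_
    rw [Measure.smul_apply, smul_eq_mul]
    refine mul_le_of_le_one_left' (ENNReal.ofReal_le_one.2 ?_)
    rw [abs_of_nonneg (by positivity)]
    exact inv_le_one_of_one_le₀ (one_le_pow₀ hj)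
  calc ∫⁻ h in B, g (y + j • h) ≤ ∫⁻ h in (fun h : Rn n => y + j • h) ⁻¹' Ω, g (y + j • h) :=
        lintegral_mono_set hB
    _ = ∫⁻ x in Ω, g x ∂(volume.map fun h : Rn n => y + j • h) := by
        rw [hemb.restrict_map, hemb.lintegral_map]
    _ ≤ ∫⁻ x in Ω, g x := lintegral_mono' (Measure.restrict_mono subset_rfl hmap) le_rfl

end DiagonalBound

section UniformBound

variable {n : ℕ} {Ω : Set (Rn n)} {K : Rn n × Rn n → ℝ} {ev : ℕ → ℝ} {φ : ℕ → Rn n → ℝ} {m : ℕ}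

lemma lintegral_shift_prod_le {R : Rn n × Rn n → ℝ}
    (hR : ContinuousOn R (Ω ×ˢ Ω)) {B : Set (Rn n)} (hB : MeasurableSet B) {y : Rn n}
    {a b : ℝ} (ha : 1 ≤ a) (hb : 1 ≤ b) (hBa : ∀ h ∈ B, y + a • h ∈ Ω)
    (hBb : ∀ h ∈ B, y + b • h ∈ Ω) :
    AEMeasurable (fun z : Rn n × Rn n => ‖R (y + a • z.1, y + b • z.2)‖ₑ ^ 2)
      ((volume.restrict B).prod (volume.restrict B)) ∧
    ∫⁻ z, ‖R (y + a • z.1, y + b • z.2)‖ₑ ^ 2 ∂((volume.restrict B).prod (volume.restrict B)) ≤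
      ∫⁻ x in Ω, ∫⁻ w in Ω, ‖R (x, w)‖ₑ ^ 2 := by
  have hmeas : AEMeasurable (fun z : Rn n × Rn n => ‖R (y + a • z.1, y + b • z.2)‖ₑ ^ 2)
      ((volume.restrict B).prod (volume.restrict B)) := by
    have hcont : ContinuousOn (fun z : Rn n × Rn n => R (y + a • z.1, y + b • z.2)) (B ×ˢ B) :=
      hR.comp (by fun_prop) fun z hz => ⟨hBa _ hz.1, hBb _ hz.2⟩
    rw [Measure.prod_restrict]
    exact (hcont.aestronglyMeasurable (hB.prod hB)).enorm.pow_const _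
  refine ⟨hmeas, ?_⟩
  rw [lintegral_prod _ hmeas]
  calc _ ≤ ∫⁻ h in B, ∫⁻ w in Ω, ‖R (y + a • h, w)‖ₑ ^ 2 :=
        lintegral_mono fun h => setLIntegral_comp_add_smul_le hb y hBb
          fun w => ‖R (y + a • h, w)‖ₑ ^ 2
    _ ≤ _ := setLIntegral_comp_add_smul_le ha y hBa fun x => ∫⁻ w in Ω, ‖R (x, w)‖ₑ ^ 2

theorem exists_mercerResidual_diag_sq_le (hΩ : IsCompact Ω) (hLip : HasLipschitzBoundary Ω)
    (hK : IsMercerKernel Ω K) (hCk : IsCk (2 * m) (Ω ×ˢ Ω) K)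
    (hev : IsPositiveEigensystem Ω K ev φ) : ∃ C r₀ : ℝ, 0 ≤ C ∧ 0 < r₀ ∧ ∀ N, ∀ y ∈ interior Ω,
      ∀ ε, 0 < ε → ε ≤ r₀ → mercerResidual K ev φ N (y, y) ^ 2 ≤
        C * (ε ^ (4 * m) + (sqTail ev N).toReal / ε ^ (2 * n)) := by
  have hbd := volume_frontier_eq_zero hΩ.isClosed hLip
  have hc := hK.continuousOn
  have hpsd := hK.isPSDKernelOn
  obtain ⟨r₀, κ, hr₀, hκ, hκ1, hcone⟩ := exists_uniform_cone hΩ hLip m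
  obtain ⟨C₀, hC₀⟩ := hCk.exists_norm_iteratedFDeriv_le hΩ (le_refl (2 * m))
  obtain ⟨C₁, hC₁, hdiag⟩ := exists_diag_sq_le (n := n) m
  have hKd := hCk.2.1
  rw [interior_prod_eq] at hKd
  set D : ℝ := max C₀ 0 * 4 ^ m with hD
  have hD0 : 0 ≤ D := by positivity
  set b : ℝ := (volume (Metric.ball (0 : Rn n) 1)).toReal with hb
  have hb0 : 0 < b := ENNReal.toReal_pos (Metric.measure_ball_pos _ _ one_pos).ne'
    measure_ball_lt_top.ne
  refine ⟨72 * D ^ 2 + C₁ * m ^ 2 / (κ ^ n * b) ^ 2, r₀, by positivity, hr₀, ?_⟩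
  intro N y hy ε hε hεr
  set R := mercerResidual K ev φ N with hR
  set S := (sqTail ev N).toReal with hS
  have hS0 : 0 ≤ S := ENNReal.toReal_nonneg
  have hRc : ContinuousOn R (Ω ×ˢ Ω) := continuousOn_mercerResidual hc hev N
  obtain ⟨ν, hν, hcone⟩ := hcone y hy
  replace hcone := hcone ε hε hεr
  set B := Metric.ball (ε • ν) (κ * ε) with hB
  have hBm : MeasurableSet B := Metric.isOpen_ball.measurableSet
  have hz : ∀ h ∈ B, zonotope (List.replicate m h) y ⊆ interior Ω := by
    intro h hh
    refine (zonotope_replicate_subset _ _ _).trans ?_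
    rintro _ ⟨s, hs, rfl⟩
    exact hcone h hh s hs
  have hnorm : ∀ h ∈ B, ‖h‖ ≤ 2 * ε := by
    intro h hh
    have h0 : ‖h - ε • ν‖ < κ * ε := mem_ball_iff_norm.1 hh
    have h1 := norm_add_le (h - ε • ν) (ε • ν)
    rw [sub_add_cancel, norm_smul, Real.norm_of_nonneg hε.le] at h1
    nlinarith
  have hform : ∀ h ∈ B, kernelForm R (diffFunctional (List.replicate m h) y)
      (diffFunctional (List.replicate m h) y) ≤ D * ε ^ (2 * m) := fun h hh =>
    (kernelForm_mercerResidual_le hev N _).trans (kernelForm_diffFunctional_replicate_le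
      isOpen_interior hKd (le_max_right _ _) (fun z hz => (hC₀ z hz).trans (le_max_left _ _))
      (hnorm h hh) (hz h hh))
  have hpt : ∀ h ∈ B, ∀ h' ∈ B, R (y, y) ^ 2 ≤ 72 * (D * ε ^ (2 * m)) ^ 2 +
      C₁ * ∑ i ∈ Finset.range m, ∑ j ∈ Finset.range m,
        R (y + ((i + 1 : ℕ) : ℝ) • h, y + ((j + 1 : ℕ) : ℝ) • h') ^ 2 := fun h hh h' hh' =>
    hdiag Ω R (isPSDKernelOn_mercerResidual hΩ hc hpsd hev N) y h h' _ (by positivity)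
      (interior_subset hy) ((hz h hh).trans interior_subset) ((hz h' hh').trans interior_subset)
      (hform h hh) (hform h' hh')
  set V : ℝ := κ ^ n * b * ε ^ n with hV
  have hV0 : 0 < V := by positivity
  have hvol : volume B = ENNReal.ofReal V := by
    rw [hB, Measure.addHaar_ball_of_pos _ _ (by positivity), finrank_euclideanSpace_fin,
      ← ENNReal.ofReal_toReal (measure_ball_lt_top (x := (0 : Rn n)) (r := 1)).ne, ← hb,
      ← ENNReal.ofReal_mul (by positivity), hV, mul_pow]
    congr 1
    ring
  set P := (volume.restrict B).prod (volume.restrict B) with hP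
  have hPu : P univ = ENNReal.ofReal (V ^ 2) := by
    rw [hP, ← univ_prod_univ, Measure.prod_prod, Measure.restrict_apply_univ, hvol,
      ← ENNReal.ofReal_mul hV0.le, pow_two]
  have hmemP : ∀ᵐ z ∂P, z ∈ B ×ˢ B := by
    rw [hP, Measure.prod_restrict]
    exact ae_restrict_mem (hBm.prod hBm)
  have hpiece : ∀ i j : ℕ, i < m → j < m → AEMeasurable (fun z : Rn n × Rn n =>
      ‖R (y + ((i + 1 : ℕ) : ℝ) • z.1, y + ((j + 1 : ℕ) : ℝ) • z.2)‖ₑ ^ 2) P ∧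
      ∫⁻ z, ‖R (y + ((i + 1 : ℕ) : ℝ) • z.1, y + ((j + 1 : ℕ) : ℝ) • z.2)‖ₑ ^ 2 ∂P ≤
        ENNReal.ofReal S := by
    intro i j hi hj
    have hin : ∀ i : ℕ, i < m → ∀ h ∈ B, y + ((i + 1 : ℕ) : ℝ) • h ∈ Ω := fun i hi h hh =>
      interior_subset (hcone h hh _ ⟨by positivity, by exact_mod_cast hi⟩)
    obtain ⟨h1, h2⟩ := lintegral_shift_prod_le hRc hBm (y := y)
      (a := ((i + 1 : ℕ) : ℝ)) (b := ((j + 1 : ℕ) : ℝ)) (by push_cast; linarith [Nat.cast_nonneg (α := ℝ) i])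
      (by push_cast; linarith [Nat.cast_nonneg (α := ℝ) j]) (hin i hi) (hin j hj)
    refine ⟨h1, h2.trans ?_⟩
    rw [hS, ENNReal.ofReal_toReal (sqTail_ne_top hΩ hc hpsd hev N)]
    exact lintegral_mercerResidual_sq_le hΩ hbd hc hpsd hev N
  have hkey : ENNReal.ofReal (R (y, y) ^ 2 * V ^ 2) ≤
      ENNReal.ofReal (72 * (D * ε ^ (2 * m)) ^ 2 * V ^ 2 + C₁ * (m ^ 2 * S)) := by
    calc ENNReal.ofReal (R (y, y) ^ 2 * V ^ 2) = ∫⁻ _, ENNReal.ofReal (R (y, y) ^ 2) ∂P := by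
          rw [lintegral_const, hPu, ENNReal.ofReal_mul (sq_nonneg _)]
      _ ≤ ∫⁻ z, (ENNReal.ofReal (72 * (D * ε ^ (2 * m)) ^ 2) + ENNReal.ofReal C₁ *
            ∑ i ∈ Finset.range m, ∑ j ∈ Finset.range m,
            ‖R (y + ((i + 1 : ℕ) : ℝ) • z.1, y + ((j + 1 : ℕ) : ℝ) • z.2)‖ₑ ^ 2) ∂P := by
          refine lintegral_mono_ae ?_
          filter_upwards [hmemP] with z hz
          refine (ENNReal.ofReal_le_ofReal (hpt z.1 hz.1 z.2 hz.2)).trans_eq ?_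
          have hnn : ∀ i ∈ Finset.range m, 0 ≤ ∑ j ∈ Finset.range m,
              R (y + ((i + 1 : ℕ) : ℝ) • z.1, y + ((j + 1 : ℕ) : ℝ) • z.2) ^ 2 := fun i _ =>
            Finset.sum_nonneg fun j _ => sq_nonneg _
          rw [ENNReal.ofReal_add (by positivity) (mul_nonneg hC₁ (Finset.sum_nonneg hnn)),
            ENNReal.ofReal_mul hC₁, ENNReal.ofReal_sum_of_nonneg hnn]
          congr 2
          refine Finset.sum_congr rfl fun i _ => ?_
          rw [ENNReal.ofReal_sum_of_nonneg fun j _ => sq_nonneg _]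
          refine Finset.sum_congr rfl fun j _ => ?_
          rw [Real.enorm_eq_ofReal_abs, ← ENNReal.ofReal_pow (abs_nonneg _), sq_abs]
      _ = ENNReal.ofReal (72 * (D * ε ^ (2 * m)) ^ 2 * V ^ 2) + ENNReal.ofReal C₁ *
            ∑ i ∈ Finset.range m, ∑ j ∈ Finset.range m,
            ∫⁻ z, ‖R (y + ((i + 1 : ℕ) : ℝ) • z.1, y + ((j + 1 : ℕ) : ℝ) • z.2)‖ₑ ^ 2 ∂P := by
          rw [lintegral_add_left measurable_const, lintegral_const, hPu,
            ← ENNReal.ofReal_mul (by positivity), lintegral_const_mul' _ _ ENNReal.ofReal_ne_top,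
            lintegral_finsetSum' _ fun i hi => Finset.aemeasurable_fun_sum _ fun j hj =>
              (hpiece i j (Finset.mem_range.1 hi) (Finset.mem_range.1 hj)).1]
          congr 2
          refine Finset.sum_congr rfl fun i hi => ?_
          rw [lintegral_finsetSum' _ fun j hj =>
            (hpiece i j (Finset.mem_range.1 hi) (Finset.mem_range.1 hj)).1]
      _ ≤ ENNReal.ofReal (72 * (D * ε ^ (2 * m)) ^ 2 * V ^ 2) + ENNReal.ofReal C₁ *
            ∑ i ∈ Finset.range m, ∑ j ∈ Finset.range m, ENNReal.ofReal S := by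
          gcongr with i hi j hj
          exact (hpiece i j (Finset.mem_range.1 hi) (Finset.mem_range.1 hj)).2
      _ = ENNReal.ofReal (72 * (D * ε ^ (2 * m)) ^ 2 * V ^ 2 + C₁ * (m ^ 2 * S)) := by
          have hm2 : ENNReal.ofReal ((m : ℝ) ^ 2 * S) = (m : ℝ≥0∞) ^ 2 * ENNReal.ofReal S := by
            rw [ENNReal.ofReal_mul (by positivity), ENNReal.ofReal_pow (by positivity),
              ENNReal.ofReal_natCast]
          rw [ENNReal.ofReal_add (by positivity) (by positivity), ENNReal.ofReal_mul hC₁, hm2]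
          simp only [Finset.sum_const, Finset.card_range, nsmul_eq_mul]
          ring
  rw [ENNReal.ofReal_le_ofReal_iff (by positivity)] at hkey
  have hmain : R (y, y) ^ 2 ≤ 72 * (D * ε ^ (2 * m)) ^ 2 + C₁ * (m ^ 2 * S) / V ^ 2 := by
    rw [← sub_le_iff_le_add', le_div_iff₀ (by positivity)]
    linarith
  refine hmain.trans ?_
  have e1 : 72 * (D * ε ^ (2 * m)) ^ 2 = 72 * D ^ 2 * ε ^ (4 * m) := by
    rw [mul_pow, ← pow_mul]
    ring
  have e2 : C₁ * (m ^ 2 * S) / V ^ 2 = C₁ * m ^ 2 / (κ ^ n * b) ^ 2 * (S / ε ^ (2 * n)) := by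
    rw [hV, mul_pow (κ ^ n * b), ← pow_mul, mul_comm n 2]
    field_simp
  rw [e1, e2, add_mul]
  have h1 : 0 ≤ S / ε ^ (2 * n) := by positivity
  have h2 : 0 ≤ ε ^ (4 * m) := by positivity
  refine add_le_add ?_ ?_
  · exact mul_le_mul_of_nonneg_left (by linarith) (by positivity)
  · exact mul_le_mul_of_nonneg_left (by linarith) (by positivity)

end UniformBound

section Rate

variable {n : ℕ} {Ω : Set (Rn n)} {K : Rn n × Rn n → ℝ} {ev : ℕ → ℝ} {φ : ℕ → Rn n → ℝ} {m : ℕ}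

/-- Optimization over the scale `ε` in a bound `C (ε^{4m} + S / ε^{2n})`. -/
lemma exists_rpow_bound (hm : 1 ≤ m) {C r₀ S₀ : ℝ} (hC : 0 ≤ C) (hr₀ : 0 < r₀)
    (hS₀ : 0 ≤ S₀) : ∃ c : ℝ, 0 ≤ c ∧ ∀ S, 0 ≤ S → S ≤ S₀ → ∀ a, 0 ≤ a →
      (∀ ε, 0 < ε → ε ≤ r₀ → a ^ 2 ≤ C * (ε ^ (4 * m) + S / ε ^ (2 * n))) →
      a ≤ c * S ^ ((m : ℝ) / (2 * m + n)) := by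
  set θ : ℝ := (m : ℝ) / (2 * m + n) with hθ
  have hm0 : (0 : ℝ) < m := by exact_mod_cast hm
  have hθ0 : 0 < θ := by positivity
  set A : ℝ := C * (r₀ ^ (4 * m) + S₀ / r₀ ^ (2 * n)) with hA
  have hA0 : 0 ≤ A := by positivity
  refine ⟨√A / S₀ ^ θ, by positivity, fun S hS hSS₀ a ha h => ?_⟩
  rcases hS.eq_or_lt with rfl | hSpos
  · rw [Real.zero_rpow hθ0.ne', mul_zero]
    have hlim : Filter.Tendsto (fun ε : ℝ => C * (ε ^ (4 * m) + 0 / ε ^ (2 * n)))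
        (nhdsWithin 0 (Ioi 0)) (nhds 0) := by
      have hcont : Continuous fun ε : ℝ => C * ε ^ (4 * m) := by fun_prop
      have := (hcont.tendsto 0).mono_left (nhdsWithin_le_nhds (s := Ioi 0))
      simpa [show m ≠ 0 by omega] using this
    have h2 : a ^ 2 ≤ 0 := by
      refine ge_of_tendsto hlim ?_
      filter_upwards [Ioc_mem_nhdsGT hr₀] with ε hε using h ε hε.1 hε.2
    nlinarith
  · have hS₀pos : 0 < S₀ := hSpos.trans_le hSS₀
    set q := S / S₀ with hq
    have hq0 : 0 < q := by positivity
    have hq1 : q ≤ 1 := (div_le_one hS₀pos).2 hSS₀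
    set τ : ℝ := q ^ (1 / (4 * (m : ℝ) + 2 * n)) with hτ
    have hτ0 : 0 < τ := Real.rpow_pos_of_pos hq0 _
    have hτ1 : τ ≤ 1 := Real.rpow_le_one hq0.le hq1 (by positivity)
    have hτq : τ ^ (4 * m + 2 * n) = q := by
      rw [hτ, ← Real.rpow_natCast, ← Real.rpow_mul hq0.le]
      push_cast
      rw [one_div_mul_cancel (by positivity), Real.rpow_one]
    have hτθ : τ ^ (2 * m) = q ^ θ := by
      rw [hτ, ← Real.rpow_natCast, ← Real.rpow_mul hq0.le, hθ]
      congr 1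
      push_cast
      field_simp
      ring
    have hε := h (r₀ * τ) (by positivity) (mul_le_of_le_one_right hr₀.le hτ1)
    have hSeq : S = S₀ * (τ ^ (4 * m) * τ ^ (2 * n)) := by
      rw [← pow_add, hτq, hq]
      field_simp
    have hfin : a ^ 2 ≤ (√A * τ ^ (2 * m)) ^ 2 := by
      refine hε.trans_eq ?_
      rw [mul_pow √A, Real.sq_sqrt hA0, hSeq, hA, ← pow_mul, show 2 * m * 2 = 4 * m by ring,
        mul_pow, mul_pow]
      field_simp
    have hle := (sq_le_sq₀ ha (by positivity)).1 hfin
    rw [hτθ, hq, Real.div_rpow hSpos.le hS₀pos.le] at hle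
    refine hle.trans_eq ?_
    ring

theorem exists_mercerError_le (hm : 1 ≤ m) (hΩ : IsCompact Ω)
    (hLip : HasLipschitzBoundary Ω) (hK : IsMercerKernel Ω K) (hCk : IsCk (2 * m) (Ω ×ˢ Ω) K)
    (hev : IsPositiveEigensystem Ω K ev φ) : ∃ c : ℝ≥0, ∀ N : ℕ, mercerError Ω K ev φ N ≤
      (c : ℝ≥0∞) * sqTail ev N ^ ((m : ℝ) / (2 * (m : ℝ) + (n : ℝ))) := by
  have hbd := volume_frontier_eq_zero hΩ.isClosed hLip
  have hcl := subset_closure_interior hLip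
  have hc := hK.continuousOn
  have hpsd := hK.isPSDKernelOn
  have hfin := sqTail_ne_top hΩ hc hpsd hev
  obtain ⟨C, r₀, hC, hr₀, hbound⟩ := exists_mercerResidual_diag_sq_le hΩ hLip hK hCk hev
  obtain ⟨c, hc0, hrate⟩ := exists_rpow_bound (n := n) hm hC hr₀
    (ENNReal.toReal_nonneg (a := sqTail ev 0))
  refine ⟨c.toNNReal, fun N => ?_⟩
  set R := mercerResidual K ev φ N with hR
  set S := (sqTail ev N).toReal with hS
  set θ : ℝ := (m : ℝ) / (2 * (m : ℝ) + (n : ℝ)) with hθ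
  have hpsdR : IsPSDKernelOn Ω R := isPSDKernelOn_mercerResidual hΩ hc hpsd hev N
  have hS0 : 0 ≤ S := ENNReal.toReal_nonneg
  have hθ0 : 0 ≤ θ := by positivity
  have hdiag : ∀ y ∈ interior Ω, R (y, y) ≤ c * S ^ θ := fun y hy =>
    hrate S hS0 (ENNReal.toReal_mono (hfin 0) (sqTail_le_sqTail_zero ev N)) _
      (hpsdR.diag_nonneg (interior_subset hy)) (hbound N y hy)
  have hoff : ∀ z ∈ interior Ω ×ˢ interior Ω, |R z| ≤ c * S ^ θ := by
    rintro ⟨x, y⟩ ⟨hx, hy⟩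
    refine abs_le_of_sq_le_sq ?_ (by positivity)
    refine (hpsdR.sq_le (interior_subset hx) (interior_subset hy)).trans ?_
    rw [pow_two]
    exact mul_le_mul (hdiag x hx) (hdiag y hy) (hpsdR.diag_nonneg (interior_subset hy))
      (by positivity)
  have hrhs : (c.toNNReal : ℝ≥0∞) * sqTail ev N ^ θ = ENNReal.ofReal (c * S ^ θ) := by
    rw [ENNReal.ofReal_mul hc0, ← ENNReal.ofReal_rpow_of_nonneg hS0 hθ0, hS,
      ENNReal.ofReal_toReal (hfin N), ENNReal.ofReal]
  rw [hrhs, mercerError_eq]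
  refine iSup₂_le fun x hx => iSup₂_le fun y hy => ?_
  refine (enorm_le_eLpNorm_top hcl (continuousOn_mercerResidual hc hev N) ⟨hx, hy⟩).trans ?_
  rw [restrict_prod_eq hbd, eLpNorm_exponent_top]
  refine eLpNormEssSup_le_of_ae_enorm_bound ?_
  filter_upwards [ae_restrict_mem (isOpen_interior.prod isOpen_interior).measurableSet] with z hz
  rw [Real.enorm_eq_ofReal_abs]
  exact ENNReal.ofReal_le_ofReal (hoff z hz)

end Rate

lemma exponent_mem_Icc {n m : ℕ} (hn : 1 ≤ n) (hm : 1 ≤ m) {p : ℝ≥0∞}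
    (hp : (n : ℝ≥0∞) / (m : ℝ≥0∞) < p) :
    (1 + 2 * (m : ℝ) / (n : ℝ) - 2 * (p⁻¹).toReal)⁻¹ ∈ Icc (0 : ℝ) 1 := by
  have h1 : p⁻¹ ≤ (m : ℝ≥0∞) / (n : ℝ≥0∞) := by
    rw [← ENNReal.inv_div (Or.inl (ENNReal.natCast_ne_top m)) (Or.inl (by simp; omega))]
    exact ENNReal.inv_le_inv.2 hp.le
  have h2 : (p⁻¹).toReal ≤ (m : ℝ) / n := by
    have := ENNReal.toReal_mono (ENNReal.div_ne_top (by simp) (by simp; omega)) h1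
    simpa using this
  have h3 : 1 ≤ 1 + 2 * (m : ℝ) / (n : ℝ) - 2 * (p⁻¹).toReal := by
    rw [mul_div_assoc]
    linarith
  exact ⟨by positivity, inv_le_one_of_one_le₀ h3⟩

theorem theorem2 (n m : ℕ) (hn : 1 ≤ n) (hm : 1 ≤ m)
    (Ω : Set (Rn n)) (hΩ : IsCompact Ω) (hLip : HasLipschitzBoundary Ω)
    (K : Rn n × Rn n → ℝ) (hK : IsMercerKernel Ω K) (hCk : IsCk (2 * m) (Ω ×ˢ Ω) K)
    (ev : ℕ → ℝ) (φ : ℕ → Rn n → ℝ) (hev : IsPositiveEigensystem Ω K ev φ) :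
    (∀ p : ℝ≥0∞, 1 ≤ p → (n : ℝ≥0∞) / (m : ℝ≥0∞) < p →
      (∀ N : ℕ, mercerError Ω K ev φ N ≤
        gnBound Ω K ev m p (1 + 2 * (m : ℝ) / (n : ℝ) - 2 * (p⁻¹).toReal)⁻¹ N) ∧
      (∀ t : ℝ, 0 ≤ t → t ≤ 1 → ∀ N : ℕ,
        mercerError Ω K ev φ N ≤ gnBound Ω K ev m p t N)) ∧
    (∃ c : ℝ≥0, ∀ N : ℕ, mercerError Ω K ev φ N ≤
      (c : ℝ≥0∞) * sqTail ev N ^ ((m : ℝ) / (2 * (m : ℝ) + (n : ℝ)))) := by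
  refine ⟨fun p hp hnp => ⟨fun N => ?_, fun t ht0 ht1 N =>
    mercerError_le_gnBound hn hΩ hLip hK hCk hev hp ht0 ht1 N⟩,
    exists_mercerError_le hm hΩ hLip hK hCk hev⟩
  obtain ⟨h0, h1⟩ := exponent_mem_Icc hn hm hnp
  exact mercerError_le_gnBound hn hΩ hLip hK hCk hev hp h0 h1 N
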